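/- **Decoupled bandit.** There are $K\ge 1$ arms. In each round $t=1,2,\dots$ an environment chooses a loss vector $\ell_t\in[0,1]^K$ and the learner chooses an exploited arm $i_t$ and an explored arm $j_t$; the learner suffers $\ell_{t,i_t}$ without observing it, and observes $\ell_{t,j_t}$ without suffering it. In the adversarial regime the environment may be randomized and adaptive: the law of $\ell_t$ may depend on all losses and arms of the rounds before $t$, and given these, $\ell_t$ is independent of $(i_t,j_t)$. A policy chooses the (joint) law of $(i_t,j_t)$ as a function of $(i_s,j_s,\ell_{s,j_s})_{s<t}$. The pseudo-regret is $$\mathrm{Reg}(T)=\mathbb E\Big[\sum_{t=1}^T\ell_{t,i_t}\Big]-\min_{i\in[K]}\mathbb E\Big[\sum_{t=1}^T\ell_{t,i}\Big].$$ **Algorithm 1 (FTPL for decoupled bandits)** with shape $\alpha>1$ and learning rates $\eta_t>0$. Put $\hat L_1=0\in\mathbb R^K$. In round $t$: draw $r_{t,1},\dots,r_{t,K}$ i.i.d. from the Pareto distribution with density $\alpha x^{-\alpha-1}$ on $[1,\infty)$ and exploit $i_t=\arg\min_{i}\{\hat L_{t,i}-r_{t,i}/\eta_t\}$; independently, explore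 $j_t\sim p_t$, where $$p_{t,i}=\frac{q_{t,i}}{\sum_{j}q_{t,j}},\qquad q_{t,i}=\min\Big\{\frac1{1+\eta_t(\hat L_{t,i}-\min_j\hat L_{t,j})},\ \frac1{\sigma_{t,i}^{1/\alpha}}\Big\}^{\frac{\alpha+1}2},$$ and $\sigma_{t,i}\in\{1,\dots,K\}$ is the rank of $\hat L_{t,i}$ among $\hat L_{t,1},\dots,\hat L_{t,K}$ in increasing order, ties being broken by an arbitrary (measurable) rule; then put $\hat L_{t+1}=\hat L_t+\ell_{t,j_t}p_{t,j_t}^{-1}e_{j_t}$. **Theorem 1.** (i) For all $\alpha>1$ and $c>0$ there is a constant $C$, depending only on $\alpha$ and $c$, such that for every $K\ge1$, every $T$, every tie-breaking rule for the ranks and every (adaptive) environment, Algorithm 1 with $\eta_t=cK^{1/\alpha-1/2}/\sqrt t$ satisfies $\mathrm{Reg}(T)\le C\sqrt{KT}$. (ii) This rate is minimax optimal: there is a universal constant $c_0>0$ such that for all $K\ge2$, $T\ge K$ and every policy there is an environment (which may be taken with i.i.d. loss vectors) in which that policy has $\mathrm{Reg}(T)\ge c_0\sqrt{KT}$. -/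

import Mathlib

open MeasureTheory ProbabilityTheory

noncomputable section

namespace DecoupledBandit

/-- The set of possible values of a loss, `[0, 1]`. -/
abbrev Loss : Type := Set.Icc (0 : ℝ) 1

/-- What happens in one round: the loss vector `ℓ`, the exploited arm `i`, the explored arm `j`. -/
abbrev Round (K : ℕ) : Type := (Fin K → Loss) × (Fin K × Fin K)

/-- What the learner knows about one round: the exploited arm `i`, the explored arm `j` and the
loss of the explored arm. -/
abbrev Obs (K : ℕ) : Type := (Fin K × Fin K) × Loss

/-- The part of a history of `t` rounds that is visible to the learner. -/
def observe {K t : ℕ} (h : Fin t → Round K) : Fin t → Obs K :=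
  fun s => ((h s).2, (h s).1 (h s).2.2)

/-- A (possibly adaptive) environment: the conditional law of the loss vector of the round after
the first `t` rounds, given everything that happened in these rounds. -/
structure Environment (K : ℕ) where
  kernel : (t : ℕ) → Kernel (Fin t → Round K) (Fin K → Loss)
  isMarkov : ∀ t, IsMarkovKernel (kernel t)

/-- The (oblivious) environment whose loss vectors are i.i.d. with law `ν`. -/
def Environment.iid {K : ℕ} (ν : ProbabilityMeasure (Fin K → Loss)) : Environment K where
  kernel _ := Kernel.const _ (ν : Measure (Fin K → Loss))
  isMarkov _ := inferInstance

/-- A decoupled policy: the conditional law of the pair (exploited arm, explored arm) of the round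
after the first `t` rounds, given what the learner observed in these rounds. -/
structure Policy (K : ℕ) where
  kernel : (t : ℕ) → Kernel (Fin t → Obs K) (Fin K × Fin K)
  isMarkov : ∀ t, IsMarkovKernel (kernel t)

attribute [instance] Environment.isMarkov Policy.isMarkov

theorem measurable_observe {K t : ℕ} : Measurable (observe (K := K) (t := t)) := by
  refine measurable_pi_lambda _ fun s => ?_
  have h1 : Measurable fun x : Round K => (x.2, x.1 x.2.2) := by
    refine measurable_snd.prodMk ?_
    have : Measurable fun y : (Fin K → Loss) × Fin K => y.1 y.2 :=
      measurable_from_prod_countable_left fun j => measurable_pi_apply j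
    exact this.comp (measurable_fst.prodMk (measurable_snd.comp measurable_snd))
  exact h1.comp (measurable_pi_apply s)

/-- The conditional law of a round given the past: given the past, the loss vector and the two arms
are independent. -/
def roundKernel {K : ℕ} (π : Policy K) (env : Environment K) (t : ℕ) :
    Kernel (Fin t → Round K) (Round K) :=
  env.kernel t ×ₖ (π.kernel t).comap observe measurable_observe

/-- The joint law of the first `t` rounds. -/
def historyMeasure {K : ℕ} (π : Policy K) (env : Environment K) :
    (t : ℕ) → Measure (Fin t → Round K)
  | 0 => Measure.dirac Fin.elim0
  | t + 1 => (historyMeasure π env t ⊗ₘ roundKernel π env t).map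
      fun x => Fin.snoc (α := fun _ => Round K) x.1 x.2

/-- The pseudo-regret
`𝔼[∑ ℓ_{t, i_t}] - min_i 𝔼[∑ ℓ_{t, i}]` of the policy `π` after `T` rounds. -/
def pseudoRegret {K : ℕ} (π : Policy K) (env : Environment K) (T : ℕ) : ℝ :=
  (∫ h, ∑ s, ((h s).1 (h s).2.1 : ℝ) ∂historyMeasure π env T) -
    ⨅ i : Fin K, ∫ h, ∑ s, ((h s).1 i : ℝ) ∂historyMeasure π env T

/-- A way to rank the entries of a vector `L` in increasing order. Ties are broken arbitrarily,
possibly depending on the round and on the observed history. Ranks are counted from `0` here. -/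
structure RankRule (K : ℕ) where
  rank : (t : ℕ) → (Fin t → Obs K) → (Fin K → ℝ) → Equiv.Perm (Fin K)
  sorted : ∀ t h L i j, rank t h L i < rank t h L j → L i ≤ L j
  measurable : ∀ t i, Measurable fun x : (Fin t → Obs K) × (Fin K → ℝ) => rank t x.1 x.2 i

section Algorithm

variable {K : ℕ}

/-- The loss-gap vector `L - 𝟏 min_j L_j`. -/
def gap (L : Fin K → ℝ) (i : Fin K) : ℝ := L i - ⨅ j, L j

/-- The unnormalised exploration weights `q_i`, for the ranks `σ_i = ρ i + 1 ∈ {1, …, K}`. -/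
def exploreWeight (α η : ℝ) (L : Fin K → ℝ) (ρ : Equiv.Perm (Fin K)) (i : Fin K) : ℝ :=
  (min (1 / (1 + η * gap L i)) (1 / (((ρ i : ℕ) : ℝ) + 1) ^ (1 / α))) ^ ((α + 1) / 2)

/-- The exploration probabilities `p_i = q_i / ∑_j q_j`. -/
def exploreProb (α η : ℝ) (L : Fin K → ℝ) (ρ : Equiv.Perm (Fin K)) (i : Fin K) : ℝ :=
  exploreWeight α η L ρ i / ∑ j, exploreWeight α η L ρ j

/-- The importance-weighted estimate of the cumulative loss vector after `t` rounds. Rounds are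
counted from `0`: the learning rate of the round that follows `t` completed rounds is `η t`. -/
def lossEst (α : ℝ) (η : ℕ → ℝ) (R : RankRule K) : (t : ℕ) → (Fin t → Obs K) → Fin K → ℝ
  | 0, _ => 0
  | t + 1, h =>
    let L := lossEst α η R t (Fin.init h)
    let j := (h (Fin.last t)).1.2
    let p := exploreProb α (η t) L (R.rank t (Fin.init h) L)
    L + Pi.single j (((h (Fin.last t)).2 : ℝ) / p j)

/-- A minimiser of `v` (the one with the smallest index). -/
def argmin [NeZero K] (v : Fin K → ℝ) : Fin K :=
  {i : Fin K | ∀ j, v i ≤ v j}.toFinset.min' (by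
    obtain ⟨i, hi⟩ := Finite.exists_min v
    exact ⟨i, by simpa using hi⟩)

theorem argmin_le [NeZero K] (v : Fin K → ℝ) (j : Fin K) : v (argmin v) ≤ v j := by
  have := Finset.min'_mem {i : Fin K | ∀ j, v i ≤ v j}.toFinset (by
    obtain ⟨i, hi⟩ := Finite.exists_min v
    exact ⟨i, by simpa using hi⟩)
  simp only [Set.mem_toFinset, Set.mem_ofPred_eq] at this
  exact this j

theorem measurable_argmin [NeZero K] : Measurable (argmin (K := K)) := by
  refine measurable_to_countable' fun i => ?_
  have : argmin (K := K) ⁻¹' {i} =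
      {v | (∀ j, v i ≤ v j) ∧ ∀ k, (∀ j, v k ≤ v j) → i ≤ k} := by
    ext v
    constructor
    · rintro rfl
      exact ⟨argmin_le v, fun k hk => Finset.min'_le _ _ (by simpa using hk)⟩
    · rintro ⟨h1, h2⟩
      refine le_antisymm (Finset.min'_le _ _ (by simpa using h1)) (h2 _ (argmin_le v))
  rw [this]
  measurability

theorem measurable_gap (i : Fin K) : Measurable fun L : Fin K → ℝ => gap L i := by
  unfold gap
  exact (measurable_pi_apply i).sub (Measurable.iInf fun j => measurable_pi_apply j)

theorem measurable_exploreWeight (α η : ℝ) (R : RankRule K) (t : ℕ) (i : Fin K) :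
    Measurable fun x : (Fin t → Obs K) × (Fin K → ℝ) =>
      exploreWeight α η x.2 (R.rank t x.1 x.2) i := by
  unfold exploreWeight
  have h1 : Measurable fun x : (Fin t → Obs K) × (Fin K → ℝ) => gap x.2 i :=
    (measurable_gap i).comp measurable_snd
  have h2 : Measurable fun x : (Fin t → Obs K) × (Fin K → ℝ) =>
      ((R.rank t x.1 x.2 i : ℕ) : ℝ) :=
    (measurable_of_countable (fun k : Fin K => ((k : ℕ) : ℝ))).comp (R.measurable t i)
  fun_prop

theorem measurable_exploreProb (α η : ℝ) (R : RankRule K) (t : ℕ) (i : Fin K) :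
    Measurable fun x : (Fin t → Obs K) × (Fin K → ℝ) =>
      exploreProb α η x.2 (R.rank t x.1 x.2) i := by
  unfold exploreProb
  exact (measurable_exploreWeight α η R t i).div
    (Finset.measurable_sum _ fun j _ => measurable_exploreWeight α η R t j)

theorem measurable_lossEst (α : ℝ) (η : ℕ → ℝ) (R : RankRule K) (t : ℕ) :
    Measurable (lossEst α η R t) := by
  induction t with
  | zero => exact measurable_const
  | succ t ih =>
    have hi : Measurable fun h : Fin (t + 1) → Obs K => (Fin.init h : Fin t → Obs K) :=
      measurable_pi_lambda _ fun s => measurable_pi_apply s.castSucc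
    have hL := ih.comp hi
    refine measurable_pi_lambda _ fun i => ?_
    have hp := (measurable_exploreProb α (η t) R t i).comp (hi.prodMk hL)
    have hl : Measurable fun h : Fin (t + 1) → Obs K => h (Fin.last t) := measurable_pi_apply _
    have heq : (fun h : Fin (t + 1) → Obs K => lossEst α η R (t + 1) h i) = fun h =>
        lossEst α η R t (Fin.init h) i + if (h (Fin.last t)).1.2 = i then
          ((h (Fin.last t)).2 : ℝ) / exploreProb α (η t) (lossEst α η R t (Fin.init h))
            (R.rank t (Fin.init h) (lossEst α η R t (Fin.init h))) i else 0 := by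
      funext h
      simp only [lossEst, Pi.add_apply, Pi.single_apply]
      by_cases hj : i = (h (Fin.last t)).1.2
      · subst hj; simp
      · simp [hj, Ne.symm hj]
    rw [heq]
    refine ((measurable_pi_apply i).comp hL).add (Measurable.ite ?_ ?_ measurable_const)
    · exact (measurable_snd.comp (measurable_fst.comp hl)) (measurableSet_singleton i)
    · exact (measurable_subtype_coe.comp (measurable_snd.comp hl)).div hp

/-- The exploited arm that results from the perturbations `r`. -/
def exploitArm [NeZero K] (α : ℝ) (η : ℕ → ℝ) (R : RankRule K) (t : ℕ)
    (x : (Fin t → Obs K) × (Fin K → ℝ)) : Fin K :=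
  argmin fun i => lossEst α η R t x.1 i - x.2 i / η t

theorem measurable_exploitArm [NeZero K] (α : ℝ) (η : ℕ → ℝ) (R : RankRule K) (t : ℕ) :
    Measurable (exploitArm α η R t) := by
  refine measurable_argmin.comp (measurable_pi_lambda _ fun i => ?_)
  exact ((measurable_pi_apply i).comp ((measurable_lossEst α η R t).comp measurable_fst)).sub
    (((measurable_pi_apply i).comp measurable_snd).div_const _)

/-- The conditional law of the exploited arm: draw i.i.d. Pareto perturbations (of scale `1` and
shape `α`) and follow the perturbed leader. -/
def exploitKernel [NeZero K] (α : ℝ) (η : ℕ → ℝ) (R : RankRule K) (t : ℕ) :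
    Kernel (Fin t → Obs K) (Fin K) :=
  (Kernel.id ×ₖ Kernel.const _ (Measure.pi fun _ : Fin K => paretoMeasure 1 α)).map
    (exploitArm α η R t)

/-- The exploration probabilities of the round that follows the observed history `h`. -/
def exploreDist (α : ℝ) (η : ℕ → ℝ) (R : RankRule K) (t : ℕ) (h : Fin t → Obs K) (i : Fin K) : ℝ :=
  exploreProb α (η t) (lossEst α η R t h) (R.rank t h (lossEst α η R t h)) i

theorem measurable_exploreDist (α : ℝ) (η : ℕ → ℝ) (R : RankRule K) (t : ℕ) (i : Fin K) :
    Measurable (fun h : Fin t → Obs K => exploreDist α η R t h i) := by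
  have h1 : Measurable fun h : Fin t → Obs K => (h, lossEst α η R t h) :=
    measurable_id.prodMk (measurable_lossEst α η R t)
  have h2 := (measurable_exploreProb α (η t) R t i).comp h1
  unfold exploreDist
  exact h2

/-- The conditional law of the explored arm. -/
def exploreKernel (α : ℝ) (η : ℕ → ℝ) (R : RankRule K) (t : ℕ) :
    Kernel (Fin t → Obs K) (Fin K) where
  toFun h := ∑ i, ENNReal.ofReal (exploreDist α η R t h i) • Measure.dirac i
  measurable' := by
    refine Measure.measurable_of_measurable_coe _ fun s _ => ?_
    simp only [Measure.coe_finsetSum, Finset.sum_apply, Measure.smul_apply, smul_eq_mul]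
    exact Finset.measurable_sum _ fun i _ =>
      (measurable_exploreDist α η R t i).ennreal_ofReal.mul_const _

theorem exploreWeight_pos {α η : ℝ} (hη : 0 < η) (L : Fin K → ℝ) (ρ : Equiv.Perm (Fin K))
    (i : Fin K) : 0 < exploreWeight α η L ρ i := by
  have hg : 0 ≤ gap L i := sub_nonneg.2 (ciInf_le (Set.finite_range L).bddBelow i)
  unfold exploreWeight
  positivity

theorem isMarkov_exploreKernel [NeZero K] {α : ℝ} {η : ℕ → ℝ} (hη : ∀ t, 0 < η t)
    (R : RankRule K) (t : ℕ) : IsMarkovKernel (exploreKernel α η R t) := by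
  refine ⟨fun h => ⟨?_⟩⟩
  have hw := fun i => exploreWeight_pos (α := α) (hη t) (lossEst α η R t h)
    (R.rank t h (lossEst α η R t h)) i
  have hs := Finset.sum_pos (fun i _ => hw i) (Finset.univ_nonempty (α := Fin K))
  have h0 : exploreKernel α η R t h Set.univ =
      ∑ i, ENNReal.ofReal (exploreDist α η R t h i) := by
    simp [exploreKernel]
  simp only [exploreDist, exploreProb] at h0
  rw [h0, ← ENNReal.ofReal_sum_of_nonneg (fun i _ => (div_pos (hw i) hs).le)]
  rw [← Finset.sum_div, div_self hs.ne', ENNReal.ofReal_one]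

theorem isMarkov_exploitKernel [NeZero K] {α : ℝ} (hα : 1 < α) (η : ℕ → ℝ)
    (R : RankRule K) (t : ℕ) : IsMarkovKernel (exploitKernel α η R t) := by
  have : IsProbabilityMeasure (paretoMeasure 1 α) :=
    isProbabilityMeasure_paretoMeasure one_pos (by linarith)
  unfold exploitKernel
  exact Kernel.IsMarkovKernel.map _ (measurable_exploitArm α η R t)

/-- Follow-the-perturbed-leader for decoupled exploration and exploitation: given the observed
history, the exploited arm and the explored arm are drawn independently. -/
def ftpl [NeZero K] (α : ℝ) (hα : 1 < α) (η : ℕ → ℝ) (hη : ∀ t, 0 < η t) (R : RankRule K) :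
    Policy K where
  kernel t := exploitKernel α η R t ×ₖ exploreKernel α η R t
  isMarkov t := by
    have := isMarkov_exploitKernel hα η R t
    have := isMarkov_exploreKernel (α := α) hη R t
    infer_instance

end Algorithm

/-- The learning rate `c K^{1/α - 1/2} / √(t + 1)`, where `t` is the number of completed rounds. -/
def learningRate (α c : ℝ) (K t : ℕ) : ℝ :=
  c * (K : ℝ) ^ (1 / α - 1 / 2) / √((t : ℝ) + 1)

theorem learningRate_pos (α : ℝ) {c : ℝ} (hc : 0 < c) (K : ℕ) [NeZero K] (t : ℕ) :
    0 < learningRate α c K t := by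
  have : 0 < K := Nat.pos_of_neZero K
  unfold learningRate
  positivity

end DecoupledBandit

end

/-!
Upper bound. The potential of the cumulative losses `L` is `Φ(L) = 𝔼 min_i (L i - r i / η)`. If the
estimate of one arm `j` grows by `x`, then `Φ` grows by at least `x` times the probability that `j`
leads afterwards, so `x` times the probability that `j` leads before exceeds the growth of `Φ` by
at most `x` times the probability that `j` is overtaken. Conditionally on the other perturbations,
this requires the perturbation of `j` to lie in an interval of length `η x` above the threshold at
which `j` takes the lead. The threshold is at least `1 + η * gap L j`, and at least the largest
perturbation of the better arms; hence the Pareto density there has expectation `O(w j ^ 2)`, where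
`w` is the exploration weight. With `x = ℓ j / p j` and `p` proportional to `w`, the overtaking
costs `O(η (∑ j, w j) ^ 2) = O(η K ^ (1 - 1 / α))` per round, while the final potential is within
`𝔼 max_i r i / η = O(K ^ (1 / α) / η)` of the regret benchmark.

Lower bound. The learner only sees the explored losses, so the likelihood ratio of its observations
when one arm `a` has mean loss `(1 - δ) / 2` and when all arms are fair coins has relative entropy
at most `δ ^ 2` times the expected number of explorations of `a`. Averaging over `a`, both the
explorations and the exploitations of `a` are a fraction `1 / K` of the rounds under fair coins, so
for `δ` of order `√(K / T)` some arm `a` is exploited in at most `3 T / 4` rounds.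
-/

namespace DecoupledBandit

open scoped ENNReal

/-! ### Pareto perturbations -/

theorem paretoMeasure_Icc_le {α x c : ℝ} (hα : 0 < α) (hx : 1 ≤ x) (hxc : x ≤ max 1 c) (δ : ℝ) :
    paretoMeasure 1 α (Set.Icc c (c + δ)) ≤ ENNReal.ofReal (α * x ^ (-(α + 1)) * δ) := by
  rw [paretoMeasure, withDensity_apply _ measurableSet_Icc, ENNReal.ofReal_mul (by positivity)]
  calc ∫⁻ y in Set.Icc c (c + δ), paretoPDF 1 α y
      ≤ ∫⁻ _ in Set.Icc c (c + δ), ENNReal.ofReal (α * x ^ (-(α + 1))) := by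
        refine setLIntegral_mono measurable_const fun y hy => ?_
        rcases lt_or_ge y 1 with h | h
        · simp [paretoPDF_of_lt h]
        · rw [paretoPDF_of_le h, Real.one_rpow, mul_one]
          refine ENNReal.ofReal_le_ofReal (mul_le_mul_of_nonneg_left ?_ hα.le)
          exact Real.rpow_le_rpow_of_nonpos (by linarith) (hxc.trans (max_le h hy.1)) (by linarith)
    _ = _ := by simp

theorem paretoMeasure_restrict_Ici {α a : ℝ} (ha : 1 ≤ a) :
    (paretoMeasure 1 α).restrict (Set.Ici a) =
      (volume.restrict (Set.Ioi a)).withDensity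
        fun x => ENNReal.ofReal (α * x ^ (-(α + 1))) := by
  rw [paretoMeasure, restrict_withDensity measurableSet_Ici,
    ← Measure.restrict_congr_set Ioi_ae_eq_Ici]
  refine withDensity_congr_ae ?_
  filter_upwards [ae_restrict_mem measurableSet_Ioi] with x hx
  rw [paretoPDF_of_le (ha.trans (Set.mem_Ioi.1 hx).le), Real.one_rpow, mul_one]

theorem integrableOn_rpow_paretoMeasure {α s a : ℝ} (hα : 0 < α) (hs : s < α) (ha : 1 ≤ a) :
    IntegrableOn (fun x => x ^ s) (Set.Ici a) (paretoMeasure 1 α) := by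
  rw [IntegrableOn, paretoMeasure_restrict_Ici ha, integrable_withDensity_iff_integrable_smul'
    (by fun_prop) (Filter.Eventually.of_forall fun _ => ENNReal.ofReal_lt_top)]
  refine ((integrableOn_Ioi_rpow_of_lt (by linarith : s - α - 1 < -1)
    (by linarith : 0 < a)).const_mul α).congr ?_
  filter_upwards [ae_restrict_mem measurableSet_Ioi] with x hx
  have hx0 : 0 < x := by linarith [Set.mem_Ioi.1 hx]
  rw [ENNReal.toReal_ofReal (by positivity), smul_eq_mul, mul_assoc, ← Real.rpow_add hx0]
  ring_nf

theorem setIntegral_rpow_paretoMeasure {α s a : ℝ} (hα : 0 < α) (hs : s < α) (ha : 1 ≤ a) :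
    ∫ x in Set.Ici a, x ^ s ∂paretoMeasure 1 α = α / (α - s) * a ^ (s - α) := by
  have ha0 : 0 < a := by linarith
  rw [paretoMeasure_restrict_Ici ha, integral_withDensity_eq_integral_toReal_smul
    (by fun_prop) (Filter.Eventually.of_forall fun _ => ENNReal.ofReal_lt_top)]
  calc ∫ x in Set.Ioi a, (ENNReal.ofReal (α * x ^ (-(α + 1)))).toReal • x ^ s
      = ∫ x in Set.Ioi a, α * x ^ (s - α - 1) := by
        refine setIntegral_congr_fun measurableSet_Ioi fun x hx => ?_
        have hx0 : 0 < x := ha0.trans hx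
        rw [ENNReal.toReal_ofReal (by positivity), smul_eq_mul, mul_assoc, ← Real.rpow_add hx0]
        ring_nf
    _ = α / (α - s) * a ^ (s - α) := by
        rw [integral_const_mul, integral_Ioi_rpow_of_lt (by linarith) ha0, sub_add_cancel,
          neg_div, ← div_neg, neg_sub, div_mul_eq_mul_div, mul_div_assoc]

theorem paretoMeasure_Iio {α x : ℝ} (hα : 0 < α) (hx : 1 ≤ x) :
    paretoMeasure 1 α (Set.Iio x) = ENNReal.ofReal (1 - x ^ (-α)) := by
  have := isProbabilityMeasure_paretoMeasure one_pos hα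
  have hIci : (paretoMeasure 1 α).real (Set.Ici x) = x ^ (-α) := by
    simpa [hα.ne'] using setIntegral_rpow_paretoMeasure (s := 0) hα hα hx
  rw [← ofReal_measureReal, ← Set.compl_Ici, probReal_compl_eq_one_sub measurableSet_Ici, hIci]

theorem ae_one_le_paretoMeasure {α : ℝ} (hα : 0 < α) : ∀ᵐ x ∂paretoMeasure 1 α, 1 ≤ x := by
  rw [ae_iff]
  simpa [Set.Iio_def] using paretoMeasure_Iio hα le_rfl

theorem integrable_of_mem_range {Ω ι : Type*} [MeasurableSpace Ω] {μ : Measure Ω} [Finite ι]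
    {f : ι → Ω → ℝ} (hf : ∀ i, Integrable (f i) μ) {g : Ω → ℝ} (hg : AEStronglyMeasurable g μ)
    (hgf : ∀ ω, g ω ∈ Set.range fun i => f i ω) : Integrable g μ := by
  have := Fintype.ofFinite ι
  refine (integrable_finsetSum Finset.univ fun i _ => (hf i).norm).mono' hg
    (Filter.Eventually.of_forall fun ω => ?_)
  obtain ⟨i, hi⟩ := hgf ω
  rw [← hi]
  exact Finset.single_le_sum (f := fun i => ‖f i ω‖) (fun i _ => norm_nonneg _) (Finset.mem_univ i)

/-- The joint law of independent Pareto perturbations indexed by `ι`. -/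
noncomputable abbrev pertMeasure (α : ℝ) (ι : Type*) [Fintype ι] : Measure (ι → ℝ) :=
  Measure.pi fun _ : ι => paretoMeasure 1 α

section Perturbation

variable {ι : Type*} [Fintype ι] {α : ℝ}

theorem isProbabilityMeasure_pertMeasure (hα : 0 < α) :
    IsProbabilityMeasure (pertMeasure α ι) := by
  have := isProbabilityMeasure_paretoMeasure one_pos hα
  infer_instance

theorem ae_one_le_pertMeasure (hα : 0 < α) : ∀ᵐ r ∂pertMeasure α ι, ∀ i, 1 ≤ r i := by
  have := isProbabilityMeasure_paretoMeasure one_pos hα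
  refine ae_all_iff.2 fun i => ?_
  exact (measurePreserving_eval (fun _ : ι => paretoMeasure 1 α) i).quasiMeasurePreserving.ae
    (ae_one_le_paretoMeasure hα)

theorem integrable_eval_pertMeasure (hα : 1 < α) (i : ι) :
    Integrable (fun r => r i) (pertMeasure α ι) := by
  have := isProbabilityMeasure_paretoMeasure one_pos (zero_lt_one.trans hα)
  refine integrable_comp_eval (μ := fun _ : ι => paretoMeasure 1 α) (f := fun x => x) ?_
  have h := integrableOn_rpow_paretoMeasure (zero_lt_one.trans hα) hα le_rfl
  have hae : ∀ᵐ x ∂paretoMeasure 1 α, x ∈ Set.Ici (1 : ℝ) :=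
    ae_one_le_paretoMeasure (zero_lt_one.trans hα)
  simpa only [IntegrableOn, Measure.restrict_eq_self_of_ae_mem hae, Real.rpow_one] using h

/-- The expectation of the largest of the perturbations indexed by `ι`. -/
noncomputable def expMaxPert (α : ℝ) (ι : Type*) [Fintype ι] : ℝ :=
  ∫ r, ⨆ i, r i ∂pertMeasure α ι

variable [Nonempty ι]

theorem integrable_iSup_pertMeasure (hα : 1 < α) :
    Integrable (fun r => ⨆ i, r i) (pertMeasure α ι) :=
  integrable_of_mem_range (integrable_eval_pertMeasure hα)
    (Measurable.iSup fun i => measurable_pi_apply i).aestronglyMeasurable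
    fun _ => exists_eq_ciSup_of_finite

theorem expMaxPert_le_add (hα : 1 < α) {a : ℝ} (ha : 1 ≤ a) :
    expMaxPert α ι ≤ a + Fintype.card ι * (α / (α - 1) * a ^ (1 - α)) := by
  have hα0 : 0 < α := by linarith
  have := isProbabilityMeasure_paretoMeasure one_pos hα0
  set g : ℝ → ℝ := (Set.Ici a).indicator fun x => x ^ (1 : ℝ) with hg
  have hg0 (x : ℝ) : 0 ≤ g x :=
    Set.indicator_nonneg (fun y (hy : a ≤ y) => Real.rpow_nonneg (by linarith) _) x
  have hg_le (x : ℝ) : x ≤ a + g x := by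
    by_cases h : a ≤ x
    · rw [hg, Set.indicator_of_mem (Set.mem_Ici.2 h), Real.rpow_one]; linarith
    · linarith [hg0 x]
  have hg_int : Integrable g (paretoMeasure 1 α) :=
    (integrableOn_rpow_paretoMeasure hα0 hα ha).integrable_indicator measurableSet_Ici
  have hsum : Integrable (fun r => ∑ i, g (r i)) (pertMeasure α ι) :=
    integrable_finsetSum _ fun i _ =>
      integrable_comp_eval (μ := fun _ : ι => paretoMeasure 1 α) hg_int
  have hle (r : ι → ℝ) : ⨆ i, r i ≤ a + ∑ i, g (r i) := ciSup_le fun i => by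
    have := Finset.single_le_sum (fun i _ => hg0 (r i)) (Finset.mem_univ i)
    linarith [hg_le (r i)]
  calc expMaxPert α ι
      ≤ ∫ r, (a + ∑ i, g (r i)) ∂pertMeasure α ι :=
        integral_mono (integrable_iSup_pertMeasure hα) ((integrable_const a).add hsum) hle
    _ = a + ∑ i, ∫ r : ι → ℝ, g (r i) ∂pertMeasure α ι := by
        rw [integral_add (integrable_const a) hsum, integral_finsetSum _ fun i _ =>
          integrable_comp_eval (μ := fun _ : ι => paretoMeasure 1 α) hg_int]
        simp
    _ = a + Fintype.card ι * (α / (α - 1) * a ^ (1 - α)) := by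
        simp only [integral_comp_eval (μ := fun _ : ι => paretoMeasure 1 α)
          hg_int.aestronglyMeasurable]
        simp [hg, integral_indicator measurableSet_Ici, ← setIntegral_rpow_paretoMeasure hα0 hα ha]

theorem expMaxPert_le (hα : 1 < α) :
    expMaxPert α ι ≤ (1 + α / (α - 1)) * (Fintype.card ι : ℝ) ^ (1 / α) := by
  have : 0 < α := by linarith
  have hn : (1 : ℝ) ≤ Fintype.card ι := by exact_mod_cast Fintype.card_pos
  have hpow : (Fintype.card ι : ℝ) * ((Fintype.card ι : ℝ) ^ (1 / α)) ^ (1 - α) =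
      (Fintype.card ι : ℝ) ^ (1 / α) := by
    have hexp : 1 + 1 / α * (1 - α) = 1 / α := by field_simp; ring
    rw [← Real.rpow_mul (by linarith), ← Real.rpow_one_add' (by linarith)
      (by rw [hexp]; positivity), hexp]
  refine (expMaxPert_le_add hα (Real.one_le_rpow hn (by positivity : 0 ≤ 1 / α))).trans_eq ?_
  rw [mul_left_comm, hpow]
  ring

end Perturbation

theorem integral_one_sub_pow_mul (n : ℕ) :
    ∫ t in (0 : ℝ)..1, (1 - t) ^ n * t = 1 / ((n + 1) * (n + 2)) := by
  have h := intervalIntegral.integral_comp_sub_left (a := 0) (b := 1)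
    (fun t : ℝ => t ^ n - t ^ (n + 1)) 1
  simp only [sub_self, sub_zero] at h
  calc ∫ t in (0 : ℝ)..1, (1 - t) ^ n * t
      = ∫ t in (0 : ℝ)..1, ((1 - t) ^ n - (1 - t) ^ (n + 1)) := by
        congr 1 with t
        ring
    _ = ∫ t in (0 : ℝ)..1, (t ^ n - t ^ (n + 1)) := h
    _ = 1 / (n + 1) - 1 / (n + 2) := by
        rw [intervalIntegral.integral_sub (by simp) (by simp), integral_pow, integral_pow]
        norm_num [add_assoc]
    _ = 1 / ((n + 1) * (n + 2)) := by
        field_simp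
        ring

section SmallMoments

variable {Ω : Type*} [MeasurableSpace Ω] {μ : Measure Ω} {Y : Ω → ℝ} {n : ℕ}

-- By the layer-cake formula the second moment is at most `2 ∫ (1 - t) ^ n * t` over `[0, 1]`.
theorem lintegral_sq_le_of_measure_lt_le (hY : Measurable Y) (h0 : ∀ ω, 0 ≤ Y ω)
    (h1 : ∀ ω, Y ω ≤ 1)
    (htail : ∀ t ∈ Set.Ioc (0 : ℝ) 1, μ {ω | t < Y ω} ≤ ENNReal.ofReal ((1 - t) ^ n)) :
    ∫⁻ ω, ENNReal.ofReal (Y ω ^ (2 : ℝ)) ∂μ ≤ ENNReal.ofReal (2 / ((n : ℝ) + 1) ^ 2) := by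
  have hle : ∀ t ∈ Set.Ioi (0 : ℝ), μ {ω | t < Y ω} * ENNReal.ofReal (t ^ ((2 : ℝ) - 1)) ≤
      (Set.Ioc (0 : ℝ) 1).indicator (fun t => ENNReal.ofReal ((1 - t) ^ n * t)) t := by
    intro t ht
    have hone : (2 : ℝ) - 1 = 1 := by norm_num
    by_cases ht1 : t ≤ 1
    · rw [Set.indicator_of_mem (Set.mem_Ioc.2 ⟨ht, ht1⟩),
        ENNReal.ofReal_mul (pow_nonneg (by linarith) _), hone, Real.rpow_one]
      gcongr
      exact htail t ⟨ht, ht1⟩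
    · have : {ω | t < Y ω} = ∅ :=
        Set.eq_empty_of_forall_notMem fun ω hω => ht1 (le_of_lt hω |>.trans (h1 ω))
      simp [this]
  have hint : ∫⁻ t in Set.Ioi (0 : ℝ), μ {ω | t < Y ω} * ENNReal.ofReal (t ^ ((2 : ℝ) - 1)) ≤
      ENNReal.ofReal (1 / ((n + 1) * (n + 2))) := by
    refine (setLIntegral_mono' measurableSet_Ioi hle).trans
      ((setLIntegral_le_lintegral _ _).trans ?_)
    rw [lintegral_indicator measurableSet_Ioc, ← ofReal_integral_eq_lintegral_ofReal,
      ← intervalIntegral.integral_of_le zero_le_one, integral_one_sub_pow_mul]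
    · exact (Continuous.integrableOn_Icc (by fun_prop)).mono_set Set.Ioc_subset_Icc_self
    · filter_upwards [ae_restrict_mem measurableSet_Ioc] with t ht
      exact mul_nonneg (pow_nonneg (by linarith [ht.2]) _) ht.1.le
  calc ∫⁻ ω, ENNReal.ofReal (Y ω ^ (2 : ℝ)) ∂μ
      ≤ ENNReal.ofReal 2 * ENNReal.ofReal (1 / ((n + 1) * (n + 2))) := by
        rw [lintegral_rpow_eq_lintegral_meas_lt_mul _ (Filter.Eventually.of_forall h0)
          hY.aemeasurable two_pos]
        gcongr
    _ ≤ ENNReal.ofReal (2 / ((n : ℝ) + 1) ^ 2) := by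
        rw [← ENNReal.ofReal_mul zero_le_two, mul_one_div]
        refine ENNReal.ofReal_le_ofReal ?_
        gcongr
        nlinarith

theorem lintegral_rpow_le_rpow_of_lintegral_rpow_le [IsProbabilityMeasure μ] {p q : ℝ}
    (hp : 0 < p) (hpq : p ≤ q) {c : ℝ} (hc : 0 ≤ c) (hY : Measurable Y) (h0 : ∀ ω, 0 ≤ Y ω)
    (h : ∫⁻ ω, ENNReal.ofReal (Y ω ^ q) ∂μ ≤ ENNReal.ofReal c) :
    ∫⁻ ω, ENNReal.ofReal (Y ω ^ p) ∂μ ≤ ENNReal.ofReal (c ^ (p / q)) := by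
  have hq : 0 < q := hp.trans_le hpq
  have hrw {s : ℝ} (hs : 0 ≤ s) (ω : Ω) : ‖Y ω‖ₑ ^ s = ENNReal.ofReal (Y ω ^ s) := by
    rw [Real.enorm_eq_ofReal (h0 ω), ENNReal.ofReal_rpow_of_nonneg (h0 ω) hs]
  have hnorm := eLpNorm'_le_eLpNorm'_of_exponent_le hp hpq μ hY.aestronglyMeasurable
  simp only [eLpNorm', hrw hp.le, hrw hq.le] at hnorm
  rw [one_div, ENNReal.rpow_inv_le_iff hp] at hnorm
  refine hnorm.trans ?_
  rw [← ENNReal.rpow_mul, one_div_mul_eq_div, ← ENNReal.ofReal_rpow_of_nonneg hc (by positivity)]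
  gcongr

end SmallMoments

section Maximum

variable {ι : Type*} (S : Finset ι)

theorem one_le_fold_max (r : ι → ℝ) : 1 ≤ S.fold max 1 r :=
  (Finset.le_fold_max _).2 (Or.inl le_rfl)

theorem measurable_fold_max : Measurable fun r : ι → ℝ => S.fold max 1 r := by
  classical
  induction S using Finset.induction_on with
  | empty => simp
  | insert i S hi ih =>
    simp only [Finset.fold_insert hi]
    exact (measurable_pi_apply i).max ih

variable [Fintype ι] {α : ℝ}

theorem pertMeasure_fold_max_lt_le (hα : 0 < α) {x : ℝ} (hx : 1 ≤ x) :
    pertMeasure α ι {r | S.fold max 1 r < x} ≤ ENNReal.ofReal ((1 - x ^ (-α)) ^ S.card) := by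
  have := isProbabilityMeasure_paretoMeasure one_pos hα
  calc pertMeasure α ι {r | S.fold max 1 r < x}
      ≤ pertMeasure α ι ((S : Set ι).pi fun _ => Set.Iio x) :=
        measure_mono fun r (hr : S.fold max 1 r < x) => ((Finset.fold_max_lt _).1 hr).2
    _ = ENNReal.ofReal ((1 - x ^ (-α)) ^ S.card) := by
        rw [Measure.pi_pi_finset, Finset.prod_const, paretoMeasure_Iio hα hx, ENNReal.ofReal_pow]
        exact sub_nonneg.2 (Real.rpow_le_one_of_one_le_of_nonpos hx (by linarith))

theorem lintegral_fold_max_rpow_sq_le (hα : 0 < α) :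
    ∫⁻ r, ENNReal.ofReal ((S.fold max 1 r ^ (-α)) ^ (2 : ℝ)) ∂pertMeasure α ι ≤
      ENNReal.ofReal (2 / ((S.card : ℝ) + 1) ^ 2) := by
  have hX (r : ι → ℝ) := one_le_fold_max S r
  refine lintegral_sq_le_of_measure_lt_le ((measurable_fold_max S).pow_const _)
    (fun r => Real.rpow_nonneg (zero_le_one.trans (hX r)) _)
    (fun r => Real.rpow_le_one_of_one_le_of_nonpos (hX r) (by linarith)) fun t ⟨ht0, ht1⟩ => ?_
  have hx : 1 ≤ t ^ (-α)⁻¹ := Real.one_le_rpow_of_pos_of_le_one_of_nonpos ht0 ht1 (by simp [hα.le])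
  have hxt : (t ^ (-α)⁻¹) ^ (-α) = t := Real.rpow_inv_rpow ht0.le (by linarith)
  refine (measure_mono fun r (hr : t < S.fold max 1 r ^ (-α)) => ?_).trans
    ((pertMeasure_fold_max_lt_le S hα hx).trans_eq (by rw [hxt]))
  refine (Real.rpow_lt_rpow_iff_of_neg ?_ ?_ (neg_lt_zero.2 hα)).1 (hxt.symm ▸ hr)
  · linarith
  · linarith [hX r]

theorem lintegral_fold_max_rpow_le (hα : 1 < α) :
    ∫⁻ r, ENNReal.ofReal (S.fold max 1 r ^ (-(α + 1))) ∂pertMeasure α ι ≤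
      ENNReal.ofReal (2 * ((S.card : ℝ) + 1) ^ (-((α + 1) / α))) := by
  have hα0 : 0 < α := by linarith
  have := isProbabilityMeasure_pertMeasure (ι := ι) hα0
  have hX (r : ι → ℝ) : 0 ≤ S.fold max 1 r := zero_le_one.trans (one_le_fold_max S r)
  have hp2 : (α + 1) / α ≤ 2 := by rw [div_le_iff₀ hα0]; linarith
  have h := lintegral_rpow_le_rpow_of_lintegral_rpow_le (p := (α + 1) / α) (by positivity) hp2
    (by positivity) ((measurable_fold_max S).pow_const (-α)) (fun r => Real.rpow_nonneg (hX r) _)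
    (lintegral_fold_max_rpow_sq_le S hα0)
  simp only [← Real.rpow_mul (hX _), neg_mul, mul_div_cancel₀ _ hα0.ne'] at h
  refine h.trans (ENNReal.ofReal_le_ofReal ?_)
  rw [Real.div_rpow zero_le_two (by positivity), ← Real.rpow_natCast_mul (by positivity),
    Real.rpow_neg (by positivity), div_eq_mul_inv, Nat.cast_ofNat, mul_div_cancel₀ _ two_ne_zero]
  gcongr
  exact Real.rpow_le_self_of_one_le one_le_two (by linarith)

end Maximum

/-! ### Being overtaken -/

theorem pi_eq_lintegral_update {ι : Type*} [Fintype ι] [DecidableEq ι] {E : ι → Type*}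
    [∀ i, MeasurableSpace (E i)] (μ : ∀ i, Measure (E i)) [∀ i, IsProbabilityMeasure (μ i)]
    (j : ι) {s : Set (∀ i, E i)} (hs : MeasurableSet s) :
    Measure.pi μ s = ∫⁻ r, μ j {y | Function.update r j y ∈ s} ∂Measure.pi μ := by
  have hf : Measurable (s.indicator (1 : (∀ i, E i) → ℝ≥0∞)) := measurable_one.indicator hs
  have hsection (r : ∀ i, E i) :
      μ j {y | Function.update r j y ∈ s} = (∫⋯∫⁻_{j}, s.indicator 1 ∂μ) r := by
    rw [lmarginal_singleton]
    exact (lintegral_indicator_one (measurable_update r hs)).symm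
  rw [← lintegral_indicator_one hs]
  simp only [hsection]
  refine lintegral_eq_of_lmarginal_eq {j} hf (hf.lmarginal μ) ?_
  simp only [lmarginal_singleton _ j, Function.update_idem, lintegral_const, measure_univ, mul_one]

section Overtaken

variable {ι : Type*}

/-- The event, in terms of the perturbations, that `j` minimises `L i - b * r i`, but is not the
unique minimiser after an increase of `L j` by `x`. -/
def overtaken (b x : ℝ) (L : ι → ℝ) (j : ι) : Set (ι → ℝ) :=
  {r | (∀ k, L j - b * r j ≤ L k - b * r k) ∧ ∃ k, k ≠ j ∧ L k - b * r k ≤ L j + x - b * r j}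

variable {α b x : ℝ} {L r : ι → ℝ} {j k : ι}

theorem measurableSet_overtaken [Countable ι] : MeasurableSet (overtaken b x L j) := by
  unfold overtaken
  measurability

variable [DecidableEq ι]

theorem update_mem_overtaken {y : ℝ} (hb : 0 < b)
    (hy : Function.update r j y ∈ overtaken b x L j) :
    (∀ k ≠ j, r k + (L j - L k) / b ≤ y) ∧ ∃ k ≠ j, y ≤ r k + (L j - L k) / b + x / b := by
  obtain ⟨hlead, k, hk, hover⟩ := hy
  refine ⟨fun i hi => ?_, k, hk, ?_⟩
  · have := hlead i
    rw [Function.update_self, Function.update_of_ne hi] at this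
    rw [← le_sub_iff_add_le', div_le_iff₀ hb]
    linarith
  · rw [Function.update_self, Function.update_of_ne hk] at hover
    rw [add_assoc, ← add_div, ← sub_le_iff_le_add', le_div_iff₀ hb]
    linarith

variable [Finite ι]

theorem exists_update_mem_overtaken_subset_Icc (hb : 0 < b) :
    ∃ c, (∀ k ≠ j, r k + (L j - L k) / b ≤ c) ∧
      {y | Function.update r j y ∈ overtaken b x L j} ⊆ Set.Icc c (c + x / b) := by
  by_cases hne : ∃ k, k ≠ j
  · obtain ⟨k₁, hk₁, hmax⟩ := Set.exists_max_image {k | k ≠ j}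
      (fun k => r k + (L j - L k) / b) (Set.toFinite _) hne
    refine ⟨_, hmax, fun y hy => ?_⟩
    obtain ⟨hle, k, hk, hge⟩ := update_mem_overtaken hb hy
    exact ⟨hle k₁ hk₁, hge.trans (by gcongr ?_ + _; exact hmax k hk)⟩
  · exact ⟨0, fun k hk => absurd ⟨k, hk⟩ hne, fun y ⟨_, k, hk, _⟩ => absurd ⟨k, hk⟩ hne⟩

theorem paretoMeasure_update_mem_overtaken_le (hα : 0 < α) (hb : 0 < b) {X : ℝ} (hX : 1 ≤ X)
    (h : X = 1 ∨ ∃ k ≠ j, X ≤ r k + (L j - L k) / b) :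
    paretoMeasure 1 α {y | Function.update r j y ∈ overtaken b x L j} ≤
      ENNReal.ofReal (α * X ^ (-(α + 1)) * (x / b)) := by
  obtain ⟨c, hc, hsub⟩ := exists_update_mem_overtaken_subset_Icc (x := x) (L := L) (r := r) hb
  refine (measure_mono hsub).trans (paretoMeasure_Icc_le hα hX ?_ _)
  rcases h with rfl | ⟨k, hk, hXk⟩
  · exact le_max_left _ _
  · exact hXk.trans ((hc k hk).trans (le_max_right _ _))

end Overtaken

section Stability

variable {ι : Type*} [Fintype ι] {α b x : ℝ} {L : ι → ℝ} {j k : ι}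

theorem pertMeasure_overtaken_le_of_le (hα : 0 < α) (hb : 0 < b) (hk : L k ≤ L j) :
    pertMeasure α ι (overtaken b x L j) ≤
      ENNReal.ofReal (α * (1 + b⁻¹ * (L j - L k)) ^ (-(α + 1)) * (x / b)) := by
  classical
  have := isProbabilityMeasure_paretoMeasure one_pos hα
  have := isProbabilityMeasure_pertMeasure (ι := ι) hα
  have hX : 0 ≤ b⁻¹ * (L j - L k) := mul_nonneg (inv_nonneg.2 hb.le) (sub_nonneg.2 hk)
  rw [pi_eq_lintegral_update _ j measurableSet_overtaken]
  calc _ ≤ ∫⁻ _, ENNReal.ofReal (α * (1 + b⁻¹ * (L j - L k)) ^ (-(α + 1)) * (x / b))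
        ∂pertMeasure α ι := by
        refine lintegral_mono_ae ?_
        filter_upwards [ae_one_le_pertMeasure hα] with r hr
        refine paretoMeasure_update_mem_overtaken_le hα hb (by linarith) ?_
        rcases eq_or_ne k j with rfl | hkj
        · exact Or.inl (by simp)
        · exact Or.inr ⟨k, hkj, by rw [div_eq_inv_mul]; linarith [hr k]⟩
    _ = _ := by simp

theorem pertMeasure_overtaken_le_card (hα : 1 < α) (hb : 0 < b) (hx : 0 ≤ x) {S : Finset ι}
    (hjS : j ∉ S) (hS : ∀ k ∈ S, L k ≤ L j) :
    pertMeasure α ι (overtaken b x L j) ≤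
      ENNReal.ofReal (2 * α * ((S.card : ℝ) + 1) ^ (-((α + 1) / α)) * (x / b)) := by
  classical
  have hα0 : 0 < α := by linarith
  have := isProbabilityMeasure_paretoMeasure one_pos hα0
  have hlead (r : ι → ℝ) :
      S.fold max 1 r = 1 ∨ ∃ k ≠ j, S.fold max 1 r ≤ r k + (L j - L k) / b := by
    rcases (Finset.le_fold_max _).1 (le_refl (S.fold max 1 r)) with h | ⟨k, hk, h⟩
    · exact Or.inl (h.antisymm (one_le_fold_max S r))
    · have : 0 ≤ (L j - L k) / b := div_nonneg (sub_nonneg.2 (hS k hk)) hb.le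
      exact Or.inr ⟨k, fun hkj => hjS (hkj ▸ hk), by linarith⟩
  rw [pi_eq_lintegral_update _ j measurableSet_overtaken]
  calc _ ≤ ∫⁻ r, ENNReal.ofReal (α * (x / b)) * ENNReal.ofReal (S.fold max 1 r ^ (-(α + 1)))
        ∂pertMeasure α ι := by
        refine lintegral_mono fun r => ?_
        rw [← ENNReal.ofReal_mul (by positivity), mul_right_comm]
        exact paretoMeasure_update_mem_overtaken_le hα0 hb (one_le_fold_max S r) (hlead r)
    _ ≤ ENNReal.ofReal (α * (x / b)) *
        ENNReal.ofReal (2 * ((S.card : ℝ) + 1) ^ (-((α + 1) / α))) := by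
        rw [lintegral_const_mul' _ _ ENNReal.ofReal_ne_top]
        gcongr
        exact lintegral_fold_max_rpow_le S hα
    _ = _ := by
        rw [← ENNReal.ofReal_mul (by positivity)]
        ring_nf

end Stability

section Weights

variable {K : ℕ}

theorem gap_nonneg (L : Fin K → ℝ) (j : Fin K) : 0 ≤ gap L j :=
  sub_nonneg.2 (ciInf_le (Set.finite_range L).bddBelow j)

theorem exploreWeight_sq {α η : ℝ} (hα : 0 < α) (hη : 0 ≤ η) (L : Fin K → ℝ)
    (ρ : Equiv.Perm (Fin K)) (j : Fin K) :
    exploreWeight α η L ρ j ^ 2 =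
      min ((1 + η * gap L j) ^ (-(α + 1))) (((ρ j : ℕ) + 1 : ℝ) ^ (-((α + 1) / α))) := by
  have hg := gap_nonneg L j
  have hρ : (0 : ℝ) ≤ (ρ j : ℕ) + 1 := by positivity
  have hmin := (Real.monotoneOn_rpow_Ici_of_exponent_nonneg (by linarith : 0 ≤ α + 1)).map_min
    (show 1 / (1 + η * gap L j) ∈ Set.Ici 0 from Set.mem_Ici.2 (by positivity))
    (show 1 / (((ρ j : ℕ) : ℝ) + 1) ^ (1 / α) ∈ Set.Ici 0 from Set.mem_Ici.2 (by positivity))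
  rw [exploreWeight, ← Real.rpow_mul_natCast (by positivity), Nat.cast_ofNat,
    div_mul_cancel₀ _ two_ne_zero, hmin, one_div, Real.inv_rpow (by positivity),
    ← Real.rpow_neg (by positivity), one_div, ← Real.rpow_neg hρ, ← Real.rpow_mul hρ]
  congr 2
  ring

theorem measureReal_overtaken_le {α b x : ℝ} (hα : 1 < α) (hb : 0 < b) (hx : 0 ≤ x)
    {L : Fin K → ℝ} {ρ : Equiv.Perm (Fin K)} (hρ : ∀ i j, ρ i < ρ j → L i ≤ L j) (j : Fin K) :
    (pertMeasure α (Fin K)).real (overtaken b x L j) ≤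
      2 * α * (x / b) * exploreWeight α b⁻¹ L ρ j ^ 2 := by
  have hα0 : 0 < α := by linarith
  have hg := gap_nonneg L j
  have : Nonempty (Fin K) := ⟨j⟩
  rw [exploreWeight_sq hα0 (inv_nonneg.2 hb.le), measureReal_def,
    mul_min_of_nonneg _ _ (by positivity)]
  refine ENNReal.toReal_le_of_le_ofReal (by positivity) ?_
  rcases min_choice (2 * α * (x / b) * (1 + b⁻¹ * gap L j) ^ (-(α + 1)))
    (2 * α * (x / b) * ((ρ j : ℕ) + 1 : ℝ) ^ (-((α + 1) / α))) with h | h <;> rw [h]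
  · obtain ⟨k, hk⟩ := exists_eq_ciInf_of_finite (f := L)
    have hgk : gap L j = L j - L k := by rw [gap, hk]
    refine (pertMeasure_overtaken_le_of_le hα0 hb (sub_nonneg.1 (hgk ▸ hg))).trans
      (ENNReal.ofReal_le_ofReal ?_)
    rw [← hgk]
    have : 0 ≤ α * (x / b) * (1 + b⁻¹ * gap L j) ^ (-(α + 1)) := by positivity
    linarith
  · have hcard : ((Finset.Iio (ρ j)).map ρ.symm.toEmbedding).card = (ρ j : ℕ) := by simp
    have := pertMeasure_overtaken_le_card (L := L) (j := j)
      (S := (Finset.Iio (ρ j)).map ρ.symm.toEmbedding) hα hb hx (by simp)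
      fun k hk => hρ k j (by simpa using hk)
    rw [hcard] at this
    exact this.trans_eq (by ring_nf)

end Weights

/-! ### The potential and the perturbed leader -/

/-- The perturbed cumulative loss of the perturbed leader, for perturbations of magnitude `b`. -/
noncomputable def leaderLoss {ι : Type*} (b : ℝ) (L r : ι → ℝ) : ℝ := ⨅ i, (L i - b * r i)

/-- The expected perturbed cumulative loss of the perturbed leader. It is the potential of the
regret analysis, at the learning rate `b⁻¹`. -/
noncomputable def potential {ι : Type*} [Fintype ι] (α b : ℝ) (L : ι → ℝ) : ℝ :=
  ∫ r, leaderLoss b L r ∂pertMeasure α ι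

section Potential

variable {ι : Type*}

theorem leaderLoss_le [Finite ι] (b : ℝ) (L r : ι → ℝ) (i : ι) :
    leaderLoss b L r ≤ L i - b * r i :=
  ciInf_le (Set.finite_range fun i => L i - b * r i).bddBelow i

theorem measurable_leaderLoss [Countable ι] (b : ℝ) :
    Measurable fun x : (ι → ℝ) × (ι → ℝ) => leaderLoss b x.1 x.2 := by
  unfold leaderLoss
  exact Measurable.iInf fun i => by fun_prop

variable [Fintype ι] {α b : ℝ}

theorem measurable_potential (hα : 0 < α) : Measurable (potential (ι := ι) α b) := by
  have := isProbabilityMeasure_pertMeasure (ι := ι) hα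
  exact ((measurable_leaderLoss b).stronglyMeasurable.integral_prod_right
    (ν := pertMeasure α ι)).measurable

variable [Nonempty ι] (L : ι → ℝ)

theorem integrable_leaderLoss (hα : 1 < α) : Integrable (leaderLoss b L) (pertMeasure α ι) := by
  have := isProbabilityMeasure_pertMeasure (ι := ι) (zero_lt_one.trans hα)
  exact integrable_of_mem_range
    (fun i => (integrable_const (L i)).sub ((integrable_eval_pertMeasure hα i).const_mul b))
    ((measurable_leaderLoss b).comp measurable_prodMk_left).aestronglyMeasurable
    fun _ => exists_eq_ciInf_of_finite

theorem potential_le (hα : 1 < α) (hb : 0 ≤ b) (i : ι) : potential α b L ≤ L i := by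
  have hα0 : 0 < α := by linarith
  have := isProbabilityMeasure_pertMeasure (ι := ι) hα0
  calc potential α b L ≤ ∫ _, L i ∂pertMeasure α ι := by
        refine integral_mono_ae (integrable_leaderLoss L hα) (integrable_const _) ?_
        filter_upwards [ae_one_le_pertMeasure hα0] with r hr
        have := mul_nonneg hb (zero_le_one.trans (hr i))
        linarith [leaderLoss_le b L r i]
    _ = L i := by simp

theorem potential_le_potential_add (hα : 1 < α) {b' : ℝ} (hb : b ≤ b') :
    potential α b L ≤ potential α b' L + (b' - b) * expMaxPert α ι := by
  rw [expMaxPert, ← integral_const_mul, potential, potential, ← integral_add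
    (integrable_leaderLoss L hα) ((integrable_iSup_pertMeasure hα).const_mul _)]
  refine integral_mono (integrable_leaderLoss L hα)
    ((integrable_leaderLoss L hα).add ((integrable_iSup_pertMeasure hα).const_mul _)) fun r => ?_
  obtain ⟨i, hi⟩ := exists_eq_ciInf_of_finite (f := fun i => L i - b' * r i)
  have hmax := mul_le_mul_of_nonneg_left (le_ciSup (Set.finite_range r).bddAbove i)
    (sub_nonneg.2 hb)
  have hlead := leaderLoss_le b L r i
  simp only [leaderLoss, ← hi] at hlead ⊢
  linarith

theorem sub_le_potential (hα : 1 < α) (hb : 0 ≤ b) {c : ℝ} (hL : ∀ i, c ≤ L i) :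
    c - b * expMaxPert α ι ≤ potential α b L := by
  have := isProbabilityMeasure_pertMeasure (ι := ι) (zero_lt_one.trans hα)
  have hM := (integrable_iSup_pertMeasure (ι := ι) hα).const_mul b
  calc c - b * expMaxPert α ι
      = ∫ r : ι → ℝ, (c - b * ⨆ i, r i) ∂pertMeasure α ι := by
        rw [integral_sub (integrable_const c) hM, integral_const_mul, expMaxPert]
        simp
    _ ≤ potential α b L := by
        refine integral_mono ((integrable_const c).sub hM) (integrable_leaderLoss L hα)
          fun r => le_ciInf fun i => ?_
        exact sub_le_sub (hL i)
          (mul_le_mul_of_nonneg_left (le_ciSup (Set.finite_range r).bddAbove i) hb)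

end Potential

/-- The arm that is exploited for the cumulative losses `L` and the perturbations `r` of
magnitude `b`. -/
noncomputable def leader {K : ℕ} [NeZero K] (b : ℝ) (L r : Fin K → ℝ) : Fin K :=
  argmin fun i => L i - b * r i

/-- The probability that `j` is the perturbed leader. -/
noncomputable def leadProb {K : ℕ} [NeZero K] (α b : ℝ) (L : Fin K → ℝ) (j : Fin K) : ℝ :=
  (pertMeasure α (Fin K)).real {r | leader b L r = j}

section LeadProb

variable {K : ℕ} [NeZero K] {α b : ℝ}

theorem leaderLoss_eq (b : ℝ) (L r : Fin K → ℝ) :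
    leaderLoss b L r = L (leader b L r) - b * r (leader b L r) :=
  le_antisymm (leaderLoss_le b L r _) (le_ciInf (argmin_le fun i => L i - b * r i))

theorem measurable_leader (b : ℝ) (L : Fin K → ℝ) : Measurable (leader b L) :=
  measurable_argmin.comp (by fun_prop)

theorem integral_comp_leader (hα : 0 < α) (b : ℝ) (L g : Fin K → ℝ) :
    ∫ r, g (leader b L r) ∂pertMeasure α (Fin K) = ∑ j, leadProb α b L j * g j := by
  have := isProbabilityMeasure_pertMeasure (ι := Fin K) hα
  have hm := measurable_leader b L
  have := Measure.isProbabilityMeasure_map (μ := pertMeasure α (Fin K)) hm.aemeasurable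
  rw [← integral_map hm.aemeasurable (measurable_of_finite g).aestronglyMeasurable,
    integral_fintype .of_finite]
  refine Finset.sum_congr rfl fun j _ => ?_
  rw [map_measureReal_apply hm (measurableSet_singleton j), smul_eq_mul]
  rfl

theorem mul_leadProb_add_single_le (hα : 1 < α) (x : ℝ) (L : Fin K → ℝ) (j : Fin K) :
    x * leadProb α b (L + Pi.single j x) j ≤
      potential α b (L + Pi.single j x) - potential α b L := by
  have := isProbabilityMeasure_pertMeasure (ι := Fin K) (zero_lt_one.trans hα)
  set L' : Fin K → ℝ := L + Pi.single j x with hL'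
  have hm : MeasurableSet {r | leader b L' r = j} :=
    measurable_leader b L' (measurableSet_singleton j)
  rw [potential, potential, ← integral_sub (integrable_leaderLoss L' hα)
    (integrable_leaderLoss L hα), leadProb, ← integral_indicator_one hm, ← integral_const_mul]
  refine integral_mono (((integrable_const (1 : ℝ)).indicator hm).const_mul x)
    ((integrable_leaderLoss L' hα).sub (integrable_leaderLoss L hα)) fun r => ?_
  have hle := leaderLoss_le b L r (leader b L' r)
  simp only [leaderLoss_eq b L' r]
  by_cases hj : leader b L' r = j
  · have hmem : r ∈ {r | leader b L' r = j} := hj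
    rw [Set.indicator_of_mem hmem]
    have hx : L' j = L j + x := by simp [hL']
    rw [hj] at hle ⊢
    rw [Pi.one_apply, hx]
    linarith
  · have hmem : r ∉ {r | leader b L' r = j} := hj
    rw [Set.indicator_of_notMem hmem]
    have hx : ∀ i ≠ j, L' i = L i := fun i hi => by simp [hL', Pi.single_eq_of_ne hi]
    rw [hx _ hj]
    linarith

theorem leadProb_le_add_overtaken (hα : 0 < α) (x : ℝ) (L : Fin K → ℝ) (j : Fin K) :
    leadProb α b L j ≤ leadProb α b (L + Pi.single j x) j +
      (pertMeasure α (Fin K)).real (overtaken b x L j) := by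
  have := isProbabilityMeasure_pertMeasure (ι := Fin K) hα
  refine (measureReal_mono fun r (hr : leader b L r = j) => ?_).trans (measureReal_union_le _ _)
  refine or_iff_not_imp_left.2 fun hne =>
    ⟨fun k => hr ▸ argmin_le (fun i => L i - b * r i) k, _, hne, ?_⟩
  have hle := (leaderLoss_eq b (L + Pi.single j x) r).ge.trans (leaderLoss_le b _ r j)
  simpa [Pi.single_eq_of_ne hne] using hle

theorem mul_leadProb_le (hα : 1 < α) (hb : 0 < b) {x : ℝ} (hx : 0 ≤ x) {L : Fin K → ℝ}
    {ρ : Equiv.Perm (Fin K)} (hρ : ∀ i j, ρ i < ρ j → L i ≤ L j) (j : Fin K) :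
    x * leadProb α b L j ≤ potential α b (L + Pi.single j x) - potential α b L +
      2 * α * b⁻¹ * (x * exploreWeight α b⁻¹ L ρ j) ^ 2 := by
  have hsplit := (leadProb_le_add_overtaken (zero_lt_one.trans hα) x L j).trans
    (add_le_add_right (measureReal_overtaken_le hα hb hx hρ j) _)
  calc x * leadProb α b L j
      ≤ x * leadProb α b (L + Pi.single j x) j +
          x * (2 * α * (x / b) * exploreWeight α b⁻¹ L ρ j ^ 2) := by
        rw [← mul_add]
        exact mul_le_mul_of_nonneg_left hsplit hx
    _ ≤ potential α b (L + Pi.single j x) - potential α b L +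
          x * (2 * α * (x / b) * exploreWeight α b⁻¹ L ρ j ^ 2) := by
        gcongr
        exact mul_leadProb_add_single_le hα x L j
    _ = _ := by ring

end LeadProb

section Weights

variable {K : ℕ} {α η : ℝ}

theorem mul_rpow_sub_one_le_rpow_sub_rpow {p x : ℝ} (hp0 : 0 ≤ p) (hp1 : p ≤ 1) (hx : 0 ≤ x) :
    p * (x + 1) ^ (p - 1) ≤ (x + 1) ^ p - x ^ p := by
  have hx1 : 0 < x + 1 := by linarith
  have hbern := rpow_one_add_le_one_add_mul_self (s := -1 / (x + 1)) (p := p)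
    (by rw [le_div_iff₀ hx1]; linarith) hp0 hp1
  have hratio : 1 + -1 / (x + 1) = x / (x + 1) := by field_simp; ring
  rw [hratio, Real.div_rpow hx hx1.le, div_le_iff₀ (by positivity)] at hbern
  rw [Real.rpow_sub_one hx1.ne']
  refine le_sub_comm.1 (hbern.trans_eq ?_)
  ring

theorem sum_rpow_sub_one_le {p : ℝ} (hp0 : 0 < p) (hp1 : p ≤ 1) (n : ℕ) :
    ∑ m ∈ Finset.range n, ((m : ℝ) + 1) ^ (p - 1) ≤ (n : ℝ) ^ p / p := by
  rw [le_div_iff₀' hp0, Finset.mul_sum]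
  calc ∑ m ∈ Finset.range n, p * ((m : ℝ) + 1) ^ (p - 1)
      ≤ ∑ m ∈ Finset.range n, (((m + 1 : ℕ) : ℝ) ^ p - (m : ℝ) ^ p) :=
        Finset.sum_le_sum fun m _ => by
          rw [Nat.cast_add_one]
          exact mul_rpow_sub_one_le_rpow_sub_rpow hp0.le hp1 m.cast_nonneg
    _ = (n : ℝ) ^ p := by
        rw [Finset.sum_range_sub fun m : ℕ => (m : ℝ) ^ p]
        simp [hp0.ne']

theorem sum_exploreWeight_le (hα : 1 < α) (hη : 0 ≤ η) (L : Fin K → ℝ) (ρ : Equiv.Perm (Fin K)) :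
    ∑ j, exploreWeight α η L ρ j ≤
      (K : ℝ) ^ ((α - 1) / (2 * α)) / ((α - 1) / (2 * α)) := by
  have : 0 < α - 1 := by linarith
  have hp1 : (α - 1) / (2 * α) ≤ 1 := by rw [div_le_one (by positivity)]; linarith
  have hw (j : Fin K) :
      exploreWeight α η L ρ j ≤ (((ρ j : ℕ) : ℝ) + 1) ^ ((α - 1) / (2 * α) - 1) := by
    have hg := gap_nonneg L j
    have hr : (0 : ℝ) ≤ ((ρ j : ℕ) : ℝ) + 1 := by positivity
    refine (Real.rpow_le_rpow (by positivity) (min_le_right _ _) (by positivity)).trans_eq ?_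
    rw [one_div, ← Real.rpow_neg hr, ← Real.rpow_mul hr]
    congr 1
    field_simp
    ring
  refine (Finset.sum_le_sum fun j _ => hw j).trans ?_
  rw [Equiv.sum_comp ρ fun k : Fin K => (((k : ℕ) : ℝ) + 1) ^ ((α - 1) / (2 * α) - 1),
    Fin.sum_univ_eq_sum_range fun m : ℕ => ((m : ℝ) + 1) ^ ((α - 1) / (2 * α) - 1)]
  exact sum_rpow_sub_one_le (by positivity) hp1 K

theorem sq_sum_exploreWeight_le (hα : 1 < α) (hη : 0 < η) (L : Fin K → ℝ)
    (ρ : Equiv.Perm (Fin K)) :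
    (∑ j, exploreWeight α η L ρ j) ^ 2 ≤ (2 * α / (α - 1)) ^ 2 * (K : ℝ) ^ (1 - 1 / α) := by
  have hexp : (α - 1) / (2 * α) * (2 : ℕ) = 1 - 1 / α := by push_cast; field_simp
  refine (pow_le_pow_left₀ (Finset.sum_nonneg fun j _ => (exploreWeight_pos hη L ρ j).le)
    (sum_exploreWeight_le hα hη.le L ρ) 2).trans_eq ?_
  rw [div_pow, ← Real.rpow_mul_natCast (by positivity), hexp, ← inv_div (2 * α), inv_pow,
    div_inv_eq_mul, mul_comm]

variable [NeZero K]

theorem exploreProb_pos (hη : 0 < η) (L : Fin K → ℝ) (ρ : Equiv.Perm (Fin K)) (i : Fin K) :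
    0 < exploreProb α η L ρ i :=
  div_pos (exploreWeight_pos hη L ρ i)
    (Finset.sum_pos (fun j _ => exploreWeight_pos hη L ρ j) Finset.univ_nonempty)

theorem sum_mul_leadProb_le {b : ℝ} (hα : 1 < α) (hb : 0 < b) {L : Fin K → ℝ}
    {ρ : Equiv.Perm (Fin K)} (hρ : ∀ i j, ρ i < ρ j → L i ≤ L j) {ℓ : Fin K → ℝ}
    (hℓ : ∀ i, ℓ i ∈ Set.Icc (0 : ℝ) 1) :
    ∑ j, leadProb α b L j * ℓ j ≤
      ∑ j, exploreProb α b⁻¹ L ρ j *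
          (potential α b (L + Pi.single j (ℓ j / exploreProb α b⁻¹ L ρ j)) - potential α b L) +
        2 * α * b⁻¹ * (∑ j, exploreWeight α b⁻¹ L ρ j) ^ 2 := by
  have hb' : 0 < b⁻¹ := inv_pos.2 hb
  set Q := ∑ j, exploreWeight α b⁻¹ L ρ j with hQ
  have hsq : 2 * α * b⁻¹ * Q ^ 2 = ∑ j, 2 * α * b⁻¹ * Q * exploreWeight α b⁻¹ L ρ j := by
    rw [← Finset.mul_sum, ← hQ]
    ring
  rw [hsq, ← Finset.sum_add_distrib]
  refine Finset.sum_le_sum fun j _ => ?_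
  have hp : 0 < exploreProb α b⁻¹ L ρ j := exploreProb_pos hb' L ρ j
  have hw : 0 < exploreWeight α b⁻¹ L ρ j := exploreWeight_pos hb' L ρ j
  have hpQ : exploreWeight α b⁻¹ L ρ j = exploreProb α b⁻¹ L ρ j * Q :=
    (div_mul_cancel₀ _ (Finset.sum_pos (fun i _ => exploreWeight_pos hb' L ρ i)
      Finset.univ_nonempty).ne').symm
  set p := exploreProb α b⁻¹ L ρ j
  set w := exploreWeight α b⁻¹ L ρ j
  calc leadProb α b L j * ℓ j
      = p * (ℓ j / p * leadProb α b L j) := by field_simp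
    _ ≤ p * (potential α b (L + Pi.single j (ℓ j / p)) - potential α b L +
          2 * α * b⁻¹ * (ℓ j / p * w) ^ 2) := by
        gcongr
        exact mul_leadProb_le hα hb (div_nonneg (hℓ j).1 hp.le) hρ j
    _ = p * (potential α b (L + Pi.single j (ℓ j / p)) - potential α b L) +
          2 * α * b⁻¹ * Q * w * ℓ j ^ 2 := by
        rw [mul_add, hpQ]
        field_simp
    _ ≤ p * (potential α b (L + Pi.single j (ℓ j / p)) - potential α b L) +
          2 * α * b⁻¹ * Q * w := by
        have hQ0 : 0 ≤ Q := Finset.sum_nonneg fun i _ => (exploreWeight_pos hb' L ρ i).le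
        exact add_le_add le_rfl
          (mul_le_of_le_one_right (by positivity) (pow_le_one₀ (hℓ j).1 (hℓ j).2))

end Weights

/-! ### Histories -/

/-- Bounded measurable real functions, the class of the functions of a history whose expectations
are compared. -/
def BddMeasurable {X : Type*} [MeasurableSpace X] (f : X → ℝ) : Prop :=
  Measurable f ∧ ∃ C, ∀ x, |f x| ≤ C

namespace BddMeasurable

variable {X Y : Type*} [MeasurableSpace X] [MeasurableSpace Y] {f g : X → ℝ}

theorem of_mem_Icc {a b : ℝ} (hf : Measurable f) (h : ∀ x, f x ∈ Set.Icc a b) :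
    BddMeasurable f :=
  ⟨hf, max |a| |b|, fun x => abs_le_max_abs_abs (h x).1 (h x).2⟩

theorem of_finite [Finite X] [MeasurableSingletonClass X] (f : X → ℝ) : BddMeasurable f := by
  obtain ⟨C, hC⟩ := (Set.finite_range fun x => |f x|).bddAbove
  exact ⟨measurable_of_finite f, C, fun x => hC ⟨x, rfl⟩⟩

theorem const (c : ℝ) : BddMeasurable fun _ : X => c := ⟨measurable_const, |c|, fun _ => le_rfl⟩

theorem add (hf : BddMeasurable f) (hg : BddMeasurable g) : BddMeasurable fun x => f x + g x := by
  obtain ⟨hf, C, hC⟩ := hf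
  obtain ⟨hg, D, hD⟩ := hg
  exact ⟨hf.add hg, C + D, fun x => (abs_add_le _ _).trans (add_le_add (hC x) (hD x))⟩

theorem mul (hf : BddMeasurable f) (hg : BddMeasurable g) : BddMeasurable fun x => f x * g x := by
  obtain ⟨hf, C, hC⟩ := hf
  obtain ⟨hg, D, hD⟩ := hg
  refine ⟨hf.mul hg, C * D, fun x => ?_⟩
  rw [abs_mul]
  exact mul_le_mul (hC x) (hD x) (abs_nonneg _) ((abs_nonneg _).trans (hC x))

theorem sub (hf : BddMeasurable f) (hg : BddMeasurable g) : BddMeasurable fun x => f x - g x := by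
  simpa only [neg_one_mul, ← sub_eq_add_neg] using hf.add ((const (-1)).mul hg)

theorem sum {ι : Type*} (s : Finset ι) {F : ι → X → ℝ} (h : ∀ i, BddMeasurable (F i)) :
    BddMeasurable fun x => ∑ i ∈ s, F i x := by
  classical
  induction s using Finset.induction_on with
  | empty => simpa only [Finset.sum_empty] using const 0
  | insert i s hi ih => simpa only [Finset.sum_insert hi] using (h i).add ih

theorem exp (hf : BddMeasurable f) : BddMeasurable fun x => Real.exp (f x) := by
  obtain ⟨hf, C, hC⟩ := hf
  exact of_mem_Icc (Real.measurable_exp.comp hf)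
    fun x => ⟨(Real.exp_pos _).le, Real.exp_le_exp.2 ((le_abs_self _).trans (hC x))⟩

theorem comp (hf : BddMeasurable f) {φ : Y → X} (hφ : Measurable φ) :
    BddMeasurable fun y => f (φ y) :=
  ⟨hf.1.comp hφ, hf.2.imp fun _ hC y => hC (φ y)⟩

theorem integrable (hf : BddMeasurable f) (μ : Measure X) [IsFiniteMeasure μ] : Integrable f μ := by
  obtain ⟨hf, C, hC⟩ := hf
  exact Integrable.of_bound hf.aestronglyMeasurable C (Filter.Eventually.of_forall hC)

theorem integral_kernel (κ : Kernel Y X) [IsMarkovKernel κ] {F : Y × X → ℝ}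
    (hF : BddMeasurable F) : BddMeasurable fun y => ∫ x, F (y, x) ∂κ y := by
  obtain ⟨hm, C, hC⟩ := hF
  refine ⟨(StronglyMeasurable.integral_kernel_prod_right' hm.stronglyMeasurable).measurable, C,
    fun y => ?_⟩
  simpa using norm_integral_le_of_norm_le_const (μ := κ y) (f := fun x => F (y, x))
    (Filter.Eventually.of_forall fun x => hC (y, x))

end BddMeasurable

/-- The history `h` followed by the round `x`. -/
abbrev snoc {X : Type*} {t : ℕ} (h : Fin t → X) (x : X) : Fin (t + 1) → X :=
  Fin.snoc (α := fun _ => X) h x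

section History

variable {K t : ℕ}

theorem measurable_snoc {X : Type*} [MeasurableSpace X] :
    Measurable fun x : (Fin t → X) × X => snoc x.1 x.2 := by
  refine measurable_pi_lambda _ fun s => ?_
  refine Fin.lastCases ?_ (fun s => ?_) s
  · simpa only [Fin.snoc_last] using measurable_snd
  · simpa only [Fin.snoc_castSucc] using measurable_fst.eval

theorem measurable_init {X : Type*} [MeasurableSpace X] :
    Measurable fun h : Fin (t + 1) → X => (Fin.init h : Fin t → X) :=
  measurable_pi_lambda _ fun s => measurable_pi_apply s.castSucc

theorem observe_snoc (h : Fin t → Round K) (x : Round K) :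
    observe (snoc h x) = snoc (observe h) (x.2, x.1 x.2.2) := by
  funext s
  refine Fin.lastCases ?_ (fun s => ?_) s <;> simp [observe]

variable (π : Policy K) (env : Environment K)

instance isMarkovKernel_roundKernel (t : ℕ) : IsMarkovKernel (roundKernel π env t) := by
  unfold roundKernel
  infer_instance

instance isProbabilityMeasure_historyMeasure (t : ℕ) :
    IsProbabilityMeasure (historyMeasure π env t) := by
  induction t with
  | zero => rw [historyMeasure]; infer_instance
  | succ t ih =>
    rw [historyMeasure]
    exact Measure.isProbabilityMeasure_map measurable_snoc.aemeasurable

theorem integral_historyMeasure_succ {f : (Fin (t + 1) → Round K) → ℝ} (hf : BddMeasurable f) :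
    ∫ h, f h ∂historyMeasure π env (t + 1) =
      ∫ h, ∫ x, f (snoc h x) ∂roundKernel π env t h ∂historyMeasure π env t := by
  rw [historyMeasure, integral_map measurable_snoc.aemeasurable hf.1.aestronglyMeasurable,
    Measure.integral_compProd ((hf.comp measurable_snoc).integrable _)]

theorem integral_historyMeasure_init {f : (Fin t → Round K) → ℝ} (hf : BddMeasurable f) :
    ∫ h, f (Fin.init h) ∂historyMeasure π env (t + 1) = ∫ h, f h ∂historyMeasure π env t := by
  rw [integral_historyMeasure_succ π env (hf.comp measurable_init)]
  simp

theorem integral_sum_historyMeasure_succ {g : Round K → ℝ} (hg : BddMeasurable g) :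
    ∫ h, ∑ s, g (h s) ∂historyMeasure π env (t + 1) =
      ∫ h, ∑ s, g (h s) ∂historyMeasure π env t +
        ∫ h, g (h (Fin.last t)) ∂historyMeasure π env (t + 1) := by
  have hs : BddMeasurable fun h : Fin t → Round K => ∑ s, g (h s) :=
    .sum _ fun s => hg.comp (measurable_pi_apply s)
  rw [← integral_historyMeasure_init π env hs, ← integral_add
    ((hs.comp measurable_init).integrable _)
    ((hg.comp (measurable_pi_apply (Fin.last t))).integrable _)]
  simp only [Fin.sum_univ_castSucc]
  rfl

theorem integral_roundKernel {g : Round K → ℝ} (hg : BddMeasurable g) (h : Fin t → Round K) :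
    ∫ x, g x ∂roundKernel π env t h =
      ∫ ℓ, ∫ a, g (ℓ, a) ∂π.kernel t (observe h) ∂env.kernel t h := by
  rw [roundKernel, Kernel.prod_apply, Kernel.comap_apply, integral_prod _ (hg.integrable _)]

theorem integral_historyMeasure_succ_mono {f g : (Fin (t + 1) → Round K) → ℝ}
    (hf : BddMeasurable f) (hg : BddMeasurable g)
    (hfg : ∀ h ℓ, ∫ a, f (snoc h (ℓ, a)) ∂π.kernel t (observe h) ≤
      ∫ a, g (snoc h (ℓ, a)) ∂π.kernel t (observe h)) :
    ∫ h, f h ∂historyMeasure π env (t + 1) ≤ ∫ h, g h ∂historyMeasure π env (t + 1) := by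
  have hround {F : (Fin (t + 1) → Round K) → ℝ} (hF : BddMeasurable F) (h : Fin t → Round K) :
      BddMeasurable fun x => F (snoc h x) := hF.comp (measurable_snoc.comp measurable_prodMk_left)
  have harms {F : (Fin (t + 1) → Round K) → ℝ} (hF : BddMeasurable F) (h : Fin t → Round K) :
      Integrable (fun ℓ => ∫ a, F (snoc h (ℓ, a)) ∂π.kernel t (observe h)) (env.kernel t h) :=
    ((hround hF h).integrable ((env.kernel t h).prod (π.kernel t (observe h)))).integral_prod_left
  rw [integral_historyMeasure_succ π env hf, integral_historyMeasure_succ π env hg]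
  refine integral_mono ((BddMeasurable.integral_kernel _ (hf.comp measurable_snoc)).integrable _)
    ((BddMeasurable.integral_kernel _ (hg.comp measurable_snoc)).integrable _) fun h => ?_
  simp only [integral_roundKernel π env (hround hf h), integral_roundKernel π env (hround hg h)]
  exact integral_mono (harms hf h) (harms hg h) (hfg h)

theorem integral_historyMeasure_succ_congr {f g : (Fin (t + 1) → Round K) → ℝ}
    (hf : BddMeasurable f) (hg : BddMeasurable g)
    (hfg : ∀ h ℓ, ∫ a, f (snoc h (ℓ, a)) ∂π.kernel t (observe h) =
      ∫ a, g (snoc h (ℓ, a)) ∂π.kernel t (observe h)) :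
    ∫ h, f h ∂historyMeasure π env (t + 1) = ∫ h, g h ∂historyMeasure π env (t + 1) :=
  le_antisymm (integral_historyMeasure_succ_mono π env hf hg fun h ℓ => (hfg h ℓ).le)
    (integral_historyMeasure_succ_mono π env hg hf fun h ℓ => (hfg h ℓ).ge)

theorem bddMeasurable_loss (i : Fin K) : BddMeasurable fun x : Round K => (x.1 i : ℝ) :=
  .of_mem_Icc (by fun_prop) fun x => (x.1 i).2

theorem bddMeasurable_exploitLoss : BddMeasurable fun x : Round K => (x.1 x.2.1 : ℝ) := by
  have heval : Measurable fun y : (Fin K → Loss) × Fin K => y.1 y.2 :=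
    measurable_from_prod_countable_left fun j => measurable_pi_apply j
  exact .of_mem_Icc (measurable_subtype_coe.comp
    (heval.comp (measurable_fst.prodMk (measurable_fst.comp measurable_snd))))
    fun x => (x.1 x.2.1).2

end History

/-! ### The upper bound -/

section ExploreProb

variable {K : ℕ} {α η : ℝ}

theorem exploreWeight_le_one (hα : 0 < α) (hη : 0 < η) (L : Fin K → ℝ)
    (ρ : Equiv.Perm (Fin K)) (i : Fin K) : exploreWeight α η L ρ i ≤ 1 := by
  have hg := mul_nonneg hη.le (gap_nonneg L i)
  refine Real.rpow_le_one (by positivity) ((min_le_left _ _).trans ?_) (by positivity)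
  rw [div_le_one (by linarith)]
  linarith

theorem exists_pos_le_exploreProb [NeZero K] (hα : 0 < α) (hη : 0 < η) {B : ℝ} (hB : 0 ≤ B) :
    ∃ c, 0 < c ∧ ∀ (L : Fin K → ℝ) (ρ : Equiv.Perm (Fin K)) (i : Fin K), gap L i ≤ B →
      c ≤ exploreProb α η L ρ i := by
  have hK : (0 : ℝ) < K := Nat.cast_pos.2 (Nat.pos_of_neZero K)
  refine ⟨(min (1 / (1 + η * B)) (1 / (K : ℝ) ^ (1 / α))) ^ ((α + 1) / 2) / K, by positivity,
    fun L ρ i hi => ?_⟩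
  have hg := gap_nonneg L i
  have hρ : ((ρ i : ℕ) : ℝ) + 1 ≤ K := by exact_mod_cast (ρ i).2
  have hsum : ∑ j, exploreWeight α η L ρ j ≤ K := by
    simpa using Finset.sum_le_sum fun j (_ : j ∈ Finset.univ) => exploreWeight_le_one hα hη L ρ j
  have hpos : 0 < ∑ j, exploreWeight α η L ρ j :=
    Finset.sum_pos (fun j _ => exploreWeight_pos hη L ρ j) Finset.univ_nonempty
  refine div_le_div₀ (exploreWeight_pos hη L ρ i).le ?_ hpos hsum
  refine Real.rpow_le_rpow (by positivity) (min_le_min ?_ ?_) (by positivity)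
  · gcongr
  · gcongr

end ExploreProb

section Algorithm

variable {K t : ℕ} {α : ℝ} {η : ℕ → ℝ}

theorem lossEst_snoc (R : RankRule K) (h : Fin t → Obs K) (o : Obs K) :
    lossEst α η R (t + 1) (snoc h o) =
      lossEst α η R t h + Pi.single o.1.2 ((o.2 : ℝ) / exploreDist α η R t h o.1.2) := by
  simp [lossEst, exploreDist]

variable [NeZero K]

theorem exists_lossEst_mem_Icc (hα : 0 < α) (hη : ∀ t, 0 < η t) (R : RankRule K) (t : ℕ) :
    ∃ B : ℝ, ∀ h i, lossEst α η R t h i ∈ Set.Icc 0 B := by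
  induction t with
  | zero => exact ⟨0, fun _ _ => by simp [lossEst]⟩
  | succ t ih =>
    obtain ⟨B, hB⟩ := ih
    have hB0 : 0 ≤ B := by
      have hmem := hB (fun _ => ((0, 0), 0)) 0
      exact hmem.1.trans hmem.2
    obtain ⟨c, hc, hcp⟩ := exists_pos_le_exploreProb (K := K) hα (hη t) hB0
    refine ⟨B + 1 / c, fun h => ?_⟩
    obtain ⟨h, o, rfl⟩ : ∃ h' o, h = snoc h' o := ⟨Fin.init h, h (Fin.last t), by simp⟩
    have hp : c ≤ exploreDist α η R t h o.1.2 := by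
      refine hcp _ _ _ ?_
      have hinf : 0 ≤ ⨅ i, lossEst α η R t h i := le_ciInf fun i => (hB h i).1
      exact (sub_le_self _ hinf).trans (hB h _).2
    have hadd : (o.2 : ℝ) / exploreDist α η R t h o.1.2 ∈ Set.Icc 0 (1 / c) :=
      ⟨div_nonneg o.2.2.1 (hc.le.trans hp), div_le_div₀ zero_le_one o.2.2.2 hc hp⟩
    intro i
    rw [lossEst_snoc, Pi.add_apply, Pi.single_apply]
    split
    · exact ⟨add_nonneg (hB h i).1 hadd.1, add_le_add (hB h i).2 hadd.2⟩
    · exact ⟨add_nonneg (hB h i).1 le_rfl, add_le_add (hB h i).2 (by positivity)⟩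

theorem bddMeasurable_lossEst (hα : 0 < α) (hη : ∀ t, 0 < η t) (R : RankRule K) (t : ℕ)
    (i : Fin K) : BddMeasurable fun h : Fin t → Round K => lossEst α η R t (observe h) i := by
  obtain ⟨B, hB⟩ := exists_lossEst_mem_Icc hα hη R t
  exact .of_mem_Icc ((measurable_pi_apply i).comp
    ((measurable_lossEst α η R t).comp measurable_observe)) fun h => hB _ i

theorem bddMeasurable_potential (hα : 1 < α) (hη : ∀ t, 0 < η t) (R : RankRule K) (t : ℕ) {b : ℝ}
    (hb : 0 ≤ b) :
    BddMeasurable fun h : Fin t → Round K => potential α b (lossEst α η R t (observe h)) := by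
  obtain ⟨B, hB⟩ := exists_lossEst_mem_Icc (zero_lt_one.trans hα) hη R t
  exact .of_mem_Icc ((measurable_potential (zero_lt_one.trans hα)).comp
    ((measurable_lossEst α η R t).comp measurable_observe)) fun h =>
    ⟨sub_le_potential _ hα hb fun i => (hB _ i).1, (potential_le _ hα hb 0).trans (hB _ 0).2⟩

theorem exploreDist_pos (hη : ∀ t, 0 < η t) (R : RankRule K) (h : Fin t → Obs K) (j : Fin K) :
    0 < exploreDist α η R t h j :=
  exploreProb_pos (hη t) _ _ j

theorem sum_exploreDist (hη : ∀ t, 0 < η t) (R : RankRule K) (h : Fin t → Obs K) :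
    ∑ j, exploreDist α η R t h j = 1 := by
  simp only [exploreDist, exploreProb, ← Finset.sum_div]
  exact div_self (Finset.sum_pos (fun i _ => exploreWeight_pos (hη t) _ _ i)
    Finset.univ_nonempty).ne'

theorem integral_exploreKernel (hη : ∀ t, 0 < η t) (R : RankRule K) (h : Fin t → Obs K)
    (g : Fin K → ℝ) :
    ∫ j, g j ∂exploreKernel α η R t h = ∑ j, exploreDist α η R t h j * g j := by
  change ∫ j, g j ∂∑ i, ENNReal.ofReal (exploreDist α η R t h i) • Measure.dirac i = _
  rw [integral_finsetSum_measure fun j _ =>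
    (integrable_dirac (by simp)).smul_measure ENNReal.ofReal_ne_top]
  refine Finset.sum_congr rfl fun j _ => ?_
  rw [integral_smul_measure, integral_dirac, ENNReal.toReal_ofReal (exploreDist_pos hη R h j).le,
    smul_eq_mul]

theorem integral_exploitKernel (hα : 0 < α) (R : RankRule K) (h : Fin t → Obs K)
    (g : Fin K → ℝ) :
    ∫ i, g i ∂exploitKernel α η R t h =
      ∑ i, leadProb α (η t)⁻¹ (lossEst α η R t h) i * g i := by
  have := isProbabilityMeasure_pertMeasure (ι := Fin K) hα
  have hm := measurable_exploitArm α η R t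
  have hg : Measurable g := measurable_of_finite g
  rw [← integral_comp_leader hα, exploitKernel, Kernel.map_apply _ hm,
    integral_map hm.aemeasurable hg.aestronglyMeasurable, Kernel.prod_apply, Kernel.id_apply,
    Kernel.const_apply, Measure.dirac_prod, integral_map (f := fun x => g (exploitArm α η R t x))
    (by fun_prop) (hg.comp hm).aestronglyMeasurable]
  simp only [exploitArm, leader, div_eq_inv_mul]

theorem integral_kernel_ftpl_fst (hα : 1 < α) (hη : ∀ t, 0 < η t) (R : RankRule K)
    (h : Fin t → Obs K) (g : Fin K → ℝ) :
    ∫ a, g a.1 ∂(ftpl α hα η hη R).kernel t h =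
      ∑ i, leadProb α (η t)⁻¹ (lossEst α η R t h) i * g i := by
  have := isMarkov_exploitKernel hα η R t
  have := isMarkov_exploreKernel (α := α) hη R t
  rw [← integral_exploitKernel (zero_lt_one.trans hα), ftpl, Kernel.prod_apply, integral_fun_fst,
    probReal_univ, one_smul]

theorem integral_kernel_ftpl_snd (hα : 1 < α) (hη : ∀ t, 0 < η t) (R : RankRule K)
    (h : Fin t → Obs K) (g : Fin K → ℝ) :
    ∫ a, g a.2 ∂(ftpl α hα η hη R).kernel t h = ∑ j, exploreDist α η R t h j * g j := by
  have := isMarkov_exploitKernel hα η R t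
  have := isMarkov_exploreKernel (α := α) hη R t
  rw [← integral_exploreKernel hη, ftpl, Kernel.prod_apply, integral_fun_snd,
    probReal_univ, one_smul]

end Algorithm

section UpperBound

variable {K t : ℕ} [NeZero K] {α : ℝ} {η : ℕ → ℝ}

theorem integral_lossEst (hα : 1 < α) (hη : ∀ t, 0 < η t) (R : RankRule K) (env : Environment K)
    (T : ℕ) (i : Fin K) :
    ∫ h, lossEst α η R T (observe h) i ∂historyMeasure (ftpl α hα η hη R) env T =
      ∫ h, ∑ s, ((h s).1 i : ℝ) ∂historyMeasure (ftpl α hα η hη R) env T := by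
  set π := ftpl α hα η hη R with hπ
  induction T with
  | zero => simp [lossEst]
  | succ t ih =>
    have hl : BddMeasurable fun h : Fin (t + 1) → Round K => ((h (Fin.last t)).1 i : ℝ) :=
      (bddMeasurable_loss i).comp (measurable_pi_apply (Fin.last t))
    have hL (t) := bddMeasurable_lossEst (zero_lt_one.trans hα) hη R t i
    rw [integral_sum_historyMeasure_succ π env (bddMeasurable_loss i), ← ih,
      ← integral_historyMeasure_init π env (hL t),
      ← integral_add (((hL t).comp measurable_init).integrable _) (hl.integrable _)]
    refine integral_historyMeasure_succ_congr π env (hL (t + 1))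
      (((hL t).comp measurable_init).add hl) fun h ℓ => ?_
    have hp := (exploreDist_pos (α := α) hη R (observe h) i).ne'
    simp only [observe_snoc, lossEst_snoc, Fin.init_snoc, Fin.snoc_last, Pi.add_apply, hπ]
    rw [integral_kernel_ftpl_snd hα hη R (observe h) fun j => lossEst α η R t (observe h) i +
      (Pi.single j ((ℓ j : ℝ) / exploreDist α η R t (observe h) j) : Fin K → ℝ) i]
    simp [mul_add, Finset.sum_add_distrib, ← Finset.sum_mul, sum_exploreDist hη, Pi.single_apply,
      mul_div_cancel₀ _ hp]

/-- The factor of the learning rate in the bound for the stability term of one round. -/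
noncomputable def stabilityConst (α : ℝ) (K : ℕ) : ℝ :=
  2 * α * ((2 * α / (α - 1)) ^ 2 * (K : ℝ) ^ (1 - 1 / α))

theorem integral_exploitLoss_last_le (hα : 1 < α) (hη : ∀ t, 0 < η t) (R : RankRule K)
    (env : Environment K) :
    ∫ h, ((h (Fin.last t)).1 (h (Fin.last t)).2.1 : ℝ)
        ∂historyMeasure (ftpl α hα η hη R) env (t + 1) ≤
      ∫ h, potential α (η t)⁻¹ (lossEst α η R (t + 1) (observe h))
          ∂historyMeasure (ftpl α hα η hη R) env (t + 1) -
        ∫ h, potential α (η t)⁻¹ (lossEst α η R t (observe h))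
          ∂historyMeasure (ftpl α hα η hη R) env t + stabilityConst α K * η t := by
  set π := ftpl α hα η hη R with hπ
  have hb : 0 < (η t)⁻¹ := inv_pos.2 (hη t)
  have hP (s) := bddMeasurable_potential hα hη R s hb.le
  have hPd := (hP (t + 1)).sub ((hP t).comp measurable_init)
  rw [← integral_historyMeasure_init π env (hP t), ← integral_sub ((hP (t + 1)).integrable _)
    (((hP t).comp measurable_init).integrable _)]
  have hconst : stabilityConst α K * η t =
      ∫ _, stabilityConst α K * η t ∂historyMeasure π env (t + 1) := by simp
  rw [hconst, ← integral_add (hPd.integrable _) (integrable_const _)]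
  refine integral_historyMeasure_succ_mono π env
    (bddMeasurable_exploitLoss.comp (measurable_pi_apply (Fin.last t))) (hPd.add (.const _))
    fun h ℓ => ?_
  simp only [observe_snoc, lossEst_snoc, Fin.init_snoc, Fin.snoc_last, hπ]
  set L := lossEst α η R t (observe h)
  have hround := sum_mul_leadProb_le hα hb (R.sorted t (observe h) L) fun i => (ℓ i).2
  rw [inv_inv] at hround
  rw [integral_kernel_ftpl_fst hα hη R (observe h) fun i => (ℓ i : ℝ),
    integral_kernel_ftpl_snd hα hη R (observe h) fun j =>
      potential α (η t)⁻¹ (L +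
        (Pi.single j ((ℓ j : ℝ) / exploreDist α η R t (observe h) j) : Fin K → ℝ)) -
          potential α (η t)⁻¹ L + stabilityConst α K * η t]
  simp only [mul_add, Finset.sum_add_distrib, ← Finset.sum_mul, sum_exploreDist hη, one_mul]
  refine hround.trans (add_le_add le_rfl ?_)
  have hw := sq_sum_exploreWeight_le hα (hη t) L (R.rank t (observe h) L)
  have hη0 := (hη t).le
  calc 2 * α * η t * (∑ j, exploreWeight α (η t) L (R.rank t (observe h) L) j) ^ 2
      ≤ 2 * α * η t * ((2 * α / (α - 1)) ^ 2 * (K : ℝ) ^ (1 - 1 / α)) := by gcongr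
    _ = stabilityConst α K * η t := by rw [stabilityConst]; ring

theorem integral_sum_exploitLoss_le (hα : 1 < α) (hη : ∀ t, 0 < η t) (hmono : Antitone η)
    (R : RankRule K) (env : Environment K) (T : ℕ) {b : ℝ} (hb0 : 0 ≤ b)
    (hb : ∀ s < T, (η s)⁻¹ ≤ b) :
    ∫ h, ∑ s, ((h s).1 (h s).2.1 : ℝ) ∂historyMeasure (ftpl α hα η hη R) env T ≤
      ∫ h, potential α b (lossEst α η R T (observe h))
          ∂historyMeasure (ftpl α hα η hη R) env T +
        b * expMaxPert α (Fin K) + stabilityConst α K * ∑ s ∈ Finset.range T, η s := by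
  set π := ftpl α hα η hη R
  induction T generalizing b with
  | zero =>
    have hpot := sub_le_potential (0 : Fin K → ℝ) hα hb0 fun _ => le_rfl
    simp only [historyMeasure, integral_dirac, Finset.univ_eq_empty, Finset.sum_empty,
      Finset.range_zero, mul_zero, add_zero]
    exact neg_le_iff_add_nonneg.1 ((zero_sub _).ge.trans hpot)
  | succ t ih =>
    have hbt : (η t)⁻¹ ≤ b := hb t t.lt_succ_self
    have hbt0 : 0 ≤ (η t)⁻¹ := (inv_pos.2 (hη t)).le
    have hP := bddMeasurable_potential hα hη R (t + 1) hbt0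
    have hPb := bddMeasurable_potential hα hη R (t + 1) hb0
    have hpast := ih hbt0 fun s hs => inv_anti₀ (hη t) (hmono hs.le)
    have hlast := integral_exploitLoss_last_le (t := t) hα hη R env
    have hrate : ∫ h, potential α (η t)⁻¹ (lossEst α η R (t + 1) (observe h))
          ∂historyMeasure π env (t + 1) ≤
        ∫ h, potential α b (lossEst α η R (t + 1) (observe h)) ∂historyMeasure π env (t + 1) +
          (b - (η t)⁻¹) * expMaxPert α (Fin K) := by
      have hconst : (b - (η t)⁻¹) * expMaxPert α (Fin K) =
          ∫ _, (b - (η t)⁻¹) * expMaxPert α (Fin K) ∂historyMeasure π env (t + 1) := by simp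
      rw [hconst, ← integral_add (hPb.integrable _) (integrable_const _)]
      exact integral_mono (hP.integrable _) ((hPb.integrable _).add (integrable_const _))
        fun h => potential_le_potential_add _ hα hbt
    rw [integral_sum_historyMeasure_succ π env bddMeasurable_exploitLoss, Finset.sum_range_succ]
    linarith

theorem pseudoRegret_ftpl_le (hα : 1 < α) (hη : ∀ t, 0 < η t) (hmono : Antitone η)
    (R : RankRule K) (env : Environment K) (T : ℕ) {b : ℝ} (hb0 : 0 ≤ b)
    (hb : ∀ s < T, (η s)⁻¹ ≤ b) :
    pseudoRegret (ftpl α hα η hη R) env T ≤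
      b * expMaxPert α (Fin K) + stabilityConst α K * ∑ s ∈ Finset.range T, η s := by
  set π := ftpl α hα η hη R
  obtain ⟨i, hi⟩ := exists_eq_ciInf_of_finite
    (f := fun i : Fin K => ∫ h, ∑ s, ((h s).1 i : ℝ) ∂historyMeasure π env T)
  have hexploit := integral_sum_exploitLoss_le hα hη hmono R env T hb0 hb
  have hpot : ∫ h, potential α b (lossEst α η R T (observe h)) ∂historyMeasure π env T ≤
      ∫ h, lossEst α η R T (observe h) i ∂historyMeasure π env T :=
    integral_mono ((bddMeasurable_potential hα hη R T hb0).integrable _)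
      ((bddMeasurable_lossEst (zero_lt_one.trans hα) hη R T i).integrable _)
      fun h => potential_le _ hα hb0 i
  rw [integral_lossEst hα hη] at hpot
  rw [pseudoRegret, ← hi]
  linarith

theorem antitone_learningRate (α : ℝ) {c : ℝ} (hc : 0 < c) (K : ℕ) :
    Antitone (learningRate α c K) := by
  intro s t hst
  unfold learningRate
  gcongr

theorem inv_learningRate_le (α : ℝ) {c : ℝ} (hc : 0 < c) {s T : ℕ} (hs : s < T) :
    (learningRate α c K s)⁻¹ ≤ √T * (K : ℝ) ^ (1 / 2 - 1 / α) / c := by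
  have hK : (0 : ℝ) < K := Nat.cast_pos.2 (Nat.pos_of_neZero K)
  have hs' : (s : ℝ) + 1 ≤ T := by exact_mod_cast hs
  calc (learningRate α c K s)⁻¹ = √((s : ℝ) + 1) * (K : ℝ) ^ (1 / 2 - 1 / α) / c := by
        rw [learningRate, inv_div, ← neg_sub (1 / α), Real.rpow_neg hK.le]
        field_simp
    _ ≤ √T * (K : ℝ) ^ (1 / 2 - 1 / α) / c := by gcongr

theorem sum_learningRate_le (α : ℝ) {c : ℝ} (hc : 0 < c) (K T : ℕ) :
    ∑ s ∈ Finset.range T, learningRate α c K s ≤ 2 * c * (K : ℝ) ^ (1 / α - 1 / 2) * √T := by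
  have hsum := sum_rpow_sub_one_le (p := 1 / 2) (by norm_num) (by norm_num) T
  calc ∑ s ∈ Finset.range T, learningRate α c K s
      = c * (K : ℝ) ^ (1 / α - 1 / 2) *
          ∑ s ∈ Finset.range T, ((s : ℝ) + 1) ^ ((1 : ℝ) / 2 - 1) := by
        rw [Finset.mul_sum]
        refine Finset.sum_congr rfl fun s _ => ?_
        have hexp : (1 : ℝ) / 2 - 1 = -(1 / 2) := by norm_num
        rw [learningRate, hexp, Real.rpow_neg (by positivity), ← Real.sqrt_eq_rpow, div_eq_mul_inv]
    _ ≤ c * (K : ℝ) ^ (1 / α - 1 / 2) * ((T : ℝ) ^ ((1 : ℝ) / 2) / (1 / 2)) := by gcongr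
    _ = 2 * c * (K : ℝ) ^ (1 / α - 1 / 2) * √T := by rw [Real.sqrt_eq_rpow]; ring

theorem pseudoRegret_ftpl_learningRate_le (hα : 1 < α) {c : ℝ} (hc : 0 < c) (R : RankRule K)
    (env : Environment K) (T : ℕ) :
    pseudoRegret (ftpl α hα (learningRate α c K) (learningRate_pos α hc K) R) env T ≤
      ((1 + α / (α - 1)) / c + 4 * α * c * (2 * α / (α - 1)) ^ 2) * √((K : ℝ) * (T : ℝ)) := by
  have : 0 < α - 1 := sub_pos.2 hα
  have hK : (0 : ℝ) < K := Nat.cast_pos.2 (Nat.pos_of_neZero K)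
  have hpert : (K : ℝ) ^ (1 / 2 - 1 / α) * (K : ℝ) ^ (1 / α) = √K := by
    rw [← Real.rpow_add hK, sub_add_cancel, Real.sqrt_eq_rpow]
  have hstab : (K : ℝ) ^ (1 - 1 / α) * (K : ℝ) ^ (1 / α - 1 / 2) = √K := by
    rw [← Real.rpow_add hK, sub_add_sub_cancel, Real.sqrt_eq_rpow]
    norm_num
  have hmax := expMaxPert_le (ι := Fin K) hα
  rw [Fintype.card_fin] at hmax
  have hstab0 : 0 ≤ stabilityConst α K := by unfold stabilityConst; positivity
  calc pseudoRegret (ftpl α hα (learningRate α c K) (learningRate_pos α hc K) R) env T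
      ≤ √T * (K : ℝ) ^ (1 / 2 - 1 / α) / c * expMaxPert α (Fin K) +
          stabilityConst α K * ∑ s ∈ Finset.range T, learningRate α c K s :=
        pseudoRegret_ftpl_le hα (learningRate_pos α hc K) (antitone_learningRate α hc K) R env T
          (by positivity) fun s hs => inv_learningRate_le α hc hs
    _ ≤ √T * (K : ℝ) ^ (1 / 2 - 1 / α) / c * ((1 + α / (α - 1)) * (K : ℝ) ^ (1 / α)) +
          stabilityConst α K * (2 * c * (K : ℝ) ^ (1 / α - 1 / 2) * √T) := by
        gcongr
        exact sum_learningRate_le α hc K T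
    _ = (1 + α / (α - 1)) / c * √T * ((K : ℝ) ^ (1 / 2 - 1 / α) * (K : ℝ) ^ (1 / α)) +
          4 * α * c * (2 * α / (α - 1)) ^ 2 * √T *
            ((K : ℝ) ^ (1 - 1 / α) * (K : ℝ) ^ (1 / α - 1 / 2)) := by
        rw [stabilityConst]
        ring
    _ = _ := by
        rw [hpert, hstab, Real.sqrt_mul hK.le]
        ring

end UpperBound

/-! ### The lower bound -/

section ChangeOfMeasure

theorem sub_one_le_of_pos {Z l : ℝ} (hZ : 0 < Z) (hl : 0 < l) :
    Z - 1 ≤ l / 2 * (Z - 1 - Real.log Z) + (Z + 1) / l := by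
  obtain ⟨s, hs, rfl⟩ : ∃ s : ℝ, 0 < s ∧ Z = s ^ 2 :=
    ⟨√Z, Real.sqrt_pos.2 hZ, (Real.sq_sqrt hZ.le).symm⟩
  have hlog : (s - 1) ^ 2 ≤ s ^ 2 - 1 - Real.log (s ^ 2) := by
    have hlog_le := Real.log_le_sub_one_of_pos hs
    rw [Real.log_pow, Nat.cast_ofNat]
    linarith
  -- AM-GM for the two factors of `s ^ 2 - 1 = (s - 1) * (s + 1)`
  have hamgm : s ^ 2 - 1 ≤ l / 2 * (s - 1) ^ 2 + (s + 1) ^ 2 / (2 * l) := by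
    have hsq : 0 ≤ (l * (s - 1) - (s + 1)) ^ 2 / (2 * l) := by positivity
    have hexpand : (l * (s - 1) - (s + 1)) ^ 2 / (2 * l) =
        l / 2 * (s - 1) ^ 2 + (s + 1) ^ 2 / (2 * l) - (s ^ 2 - 1) := by
      field_simp
      ring
    linarith
  have hadd : (s + 1) ^ 2 / (2 * l) ≤ (s ^ 2 + 1) / l := by
    rw [div_le_div_iff₀ (by positivity) hl]
    nlinarith [mul_nonneg hl.le (sq_nonneg (s - 1))]
  have hmul := mul_le_mul_of_nonneg_left hlog (half_pos hl).le
  linarith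

theorem integral_mul_exp_le {Ω : Type*} [MeasurableSpace Ω] {μ : Measure Ω} [IsProbabilityMeasure μ]
    {f W : Ω → ℝ} (hf : BddMeasurable f) (hW : BddMeasurable W)
    (hW1 : ∫ x, Real.exp (W x) ∂μ = 1) {N l : ℝ} (hl : 0 < l) (hfN : ∀ x, f x ∈ Set.Icc 0 N) :
    ∫ x, f x * Real.exp (W x) ∂μ ≤ ∫ x, f x ∂μ + N * (2 / l - l / 2 * ∫ x, W x ∂μ) := by
  have hpt (x : Ω) : f x * Real.exp (W x) - f x ≤
      N * ((l / 2 + 1 / l) * Real.exp (W x) + (1 / l - l / 2) - l / 2 * W x) := by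
    have hZ := sub_one_le_of_pos (Real.exp_pos (W x)) hl
    have hlog := Real.add_one_le_exp (W x)
    rw [Real.log_exp] at hZ
    have hrhs : 0 ≤ l / 2 * (Real.exp (W x) - 1 - W x) + (Real.exp (W x) + 1) / l :=
      add_nonneg (mul_nonneg (half_pos hl).le (by linarith)) (by positivity)
    calc f x * Real.exp (W x) - f x = f x * (Real.exp (W x) - 1) := by ring
      _ ≤ f x * (l / 2 * (Real.exp (W x) - 1 - W x) + (Real.exp (W x) + 1) / l) :=
        mul_le_mul_of_nonneg_left hZ (hfN x).1
      _ ≤ N * (l / 2 * (Real.exp (W x) - 1 - W x) + (Real.exp (W x) + 1) / l) :=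
        mul_le_mul_of_nonneg_right (hfN x).2 hrhs
      _ = _ := by ring
  have hfi := hf.integrable μ
  have hWi := (hW.integrable μ).const_mul (l / 2)
  have hei := (hW.exp.integrable μ).const_mul (l / 2 + 1 / l)
  have hfei := (hf.mul hW.exp).integrable μ
  have hec : Integrable (fun x => (l / 2 + 1 / l) * Real.exp (W x) + (1 / l - l / 2)) μ :=
    hei.add (integrable_const _)
  have hint : ∫ x, (f x * Real.exp (W x) - f x) ∂μ ≤
      ∫ x, N * ((l / 2 + 1 / l) * Real.exp (W x) + (1 / l - l / 2) - l / 2 * W x) ∂μ :=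
    integral_mono (hfei.sub hfi) ((hec.sub hWi).const_mul N) hpt
  rw [integral_sub hfei hfi, integral_const_mul, integral_sub hec hWi,
    integral_add hei (integrable_const _), integral_const_mul, integral_const_mul, hW1,
    integral_const, probReal_univ, one_smul] at hint
  linear_combination hint

end ChangeOfMeasure

section ProductEnv

variable {K t : ℕ}

/-- The environment whose losses are independent over arms and rounds, arm `i` having losses of law
`ν i`. -/
noncomputable def productEnv (ν : Fin K → ProbabilityMeasure Loss) : Environment K :=
  Environment.iid (.pi ν)

variable (π : Policy K) (ν : Fin K → ProbabilityMeasure Loss)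

theorem measurable_arms_loss (φ : Fin K × Fin K → Fin K) :
    Measurable fun x : Round K => (x.2, x.1 (φ x.2)) := by
  have heval : Measurable fun y : (Fin K → Loss) × Fin K × Fin K => y.1 (φ y.2) :=
    measurable_from_prod_countable_left fun a => measurable_pi_apply (φ a)
  exact measurable_snd.prodMk heval

theorem integral_roundKernel_productEnv (φ : Fin K × Fin K → Fin K) {g : Obs K → ℝ}
    (hg : BddMeasurable g) (h : Fin t → Round K) :
    ∫ x, g (x.2, x.1 (φ x.2)) ∂roundKernel π (productEnv ν) t h =
      ∫ a, ∫ y, g (a, y) ∂(ν (φ a) : Measure Loss) ∂π.kernel t (observe h) := by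
  rw [roundKernel, Kernel.prod_apply, Kernel.comap_apply,
    integral_prod_symm _ ((hg.comp (measurable_arms_loss φ)).integrable _)]
  refine integral_congr_ae (.of_forall fun a => ?_)
  have heval := measurePreserving_eval (fun i => (ν i : Measure Loss)) (φ a)
  have hga : Measurable fun y => g (a, y) := hg.1.comp measurable_prodMk_left
  have hmap := integral_map (μ := Measure.pi fun i => (ν i : Measure Loss))
    heval.measurable.aemeasurable hga.aestronglyMeasurable
  rw [heval.map_eq] at hmap
  exact hmap.symm

theorem integral_sum_productEnv (T : ℕ) (φ : Fin K × Fin K → Fin K) {g : Obs K → ℝ}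
    (hg : BddMeasurable g) :
    ∫ h, ∑ s, g ((h s).2, (h s).1 (φ (h s).2)) ∂historyMeasure π (productEnv ν) T =
      ∫ h, ∑ s, ∫ y, g ((h s).2, y) ∂(ν (φ (h s).2) : Measure Loss)
        ∂historyMeasure π (productEnv ν) T := by
  have hg' : BddMeasurable fun x : Round K => g (x.2, x.1 (φ x.2)) :=
    hg.comp (measurable_arms_loss φ)
  have hu : BddMeasurable fun a => ∫ y, g (a, y) ∂(ν (φ a) : Measure Loss) := .of_finite _
  induction T with
  | zero => simp
  | succ t ih =>
    rw [integral_sum_historyMeasure_succ π _ hg',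
      integral_sum_historyMeasure_succ π _ (hu.comp measurable_snd), ih,
      integral_historyMeasure_succ π _ (hg'.comp (measurable_pi_apply (Fin.last t))),
      integral_historyMeasure_succ π _
        ((hu.comp measurable_snd).comp (measurable_pi_apply (Fin.last t)))]
    have hround (h : Fin t → Round K) :=
      integral_roundKernel_productEnv π ν φ (hu.comp measurable_fst) h
    simp only [integral_const, probReal_univ, one_smul] at hround
    simp only [Fin.snoc_last, integral_roundKernel_productEnv π ν φ hg, hround]

theorem integral_observe_productEnv_succ {f : (Fin (t + 1) → Obs K) → ℝ} (hf : BddMeasurable f) :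
    ∫ h, f (observe h) ∂historyMeasure π (productEnv ν) (t + 1) =
      ∫ h, ∫ a, ∫ y, f (snoc (observe h) (a, y)) ∂(ν a.2 : Measure Loss) ∂π.kernel t (observe h)
        ∂historyMeasure π (productEnv ν) t := by
  rw [integral_historyMeasure_succ π _ (hf.comp measurable_observe)]
  simp only [observe_snoc]
  have hsnoc (o : Fin t → Obs K) : BddMeasurable fun x : Obs K => f (snoc o x) :=
    hf.comp (measurable_snoc.comp measurable_prodMk_left)
  simp only [integral_roundKernel_productEnv π ν Prod.snd (hsnoc _)]

theorem bddMeasurable_integral_snoc {f : (Fin (t + 1) → Obs K) → ℝ} (hf : BddMeasurable f) :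
    BddMeasurable fun o => ∫ a, ∫ y, f (snoc o (a, y)) ∂(ν a.2 : Measure Loss) ∂π.kernel t o := by
  let κ : Kernel (Fin K × Fin K) Loss := .ofFunOfCountable fun a => (ν a.2 : Measure Loss)
  have : IsMarkovKernel κ :=
    ⟨fun a => inferInstanceAs (IsProbabilityMeasure (ν a.2 : Measure Loss))⟩
  have hF : BddMeasurable fun x : ((Fin t → Obs K) × Fin K × Fin K) × Loss =>
      f (snoc x.1.1 (x.1.2, x.2)) :=
    hf.comp (measurable_snoc.comp
      (measurable_fst.fst.prodMk (measurable_fst.snd.prodMk measurable_snd)))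
  exact .integral_kernel (π.kernel t)
    (BddMeasurable.integral_kernel (κ.comap Prod.snd measurable_snd) hF)

variable {ν} {ν₀ : Fin K → ProbabilityMeasure Loss} {w : Fin K → Loss → ℝ}

theorem bddMeasurable_logLik (hw : ∀ j, BddMeasurable (w j)) :
    BddMeasurable fun o : Obs K => w o.1.2 o.2 := by
  choose hm C hC using hw
  have huncurry : Measurable fun x : Fin K × Loss => w x.1 x.2 :=
    measurable_from_prod_countable_right hm
  exact ⟨huncurry.comp ((measurable_snd.comp measurable_fst).prodMk measurable_snd), ∑ j, |C j|,
    fun o => ((hC _ _).trans (le_abs_self _)).trans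
      (Finset.single_le_sum (fun j _ => abs_nonneg (C j)) (Finset.mem_univ o.1.2))⟩

theorem bddMeasurable_sum_logLik (T : ℕ) (hw : ∀ j, BddMeasurable (w j)) :
    BddMeasurable fun o : Fin T → Obs K => ∑ s, w (o s).1.2 (o s).2 :=
  .sum _ fun s => (bddMeasurable_logLik hw).comp (measurable_pi_apply s)

theorem integral_observe_productEnv_eq (hw : ∀ j, BddMeasurable (w j))
    (hν : ∀ j, ∀ g : Loss → ℝ, BddMeasurable g →
      ∫ y, g y ∂(ν j : Measure Loss) = ∫ y, g y * Real.exp (w j y) ∂(ν₀ j : Measure Loss))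
    {T : ℕ} {f : (Fin T → Obs K) → ℝ} (hf : BddMeasurable f) :
    ∫ h, f (observe h) ∂historyMeasure π (productEnv ν) T =
      ∫ h, f (observe h) * Real.exp (∑ s, w (observe h s).1.2 (observe h s).2)
        ∂historyMeasure π (productEnv ν₀) T := by
  induction T with
  | zero => simp [historyMeasure]
  | succ t ih =>
    rw [integral_observe_productEnv_succ π ν hf, integral_observe_productEnv_succ π ν₀
      (hf.mul (bddMeasurable_sum_logLik (t + 1) hw).exp), ih (bddMeasurable_integral_snoc π ν hf)]
    have hsnoc (o : Fin t → Obs K) (a : Fin K × Fin K) : BddMeasurable fun y => f (snoc o (a, y)) :=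
      hf.comp (measurable_snoc.comp (measurable_prodMk_left.comp measurable_prodMk_left))
    have hround (o : Fin t → Obs K) (a : Fin K × Fin K) := hν a.2 _ (hsnoc o a)
    simp only [hround, Fin.sum_univ_castSucc, Fin.snoc_castSucc, Fin.snoc_last, Real.exp_add,
      mul_left_comm _ (Real.exp (∑ _, _)), integral_const_mul]
    simp only [mul_comm]

theorem integral_observe_productEnv_le (hw : ∀ j, BddMeasurable (w j))
    (hν : ∀ j, ∀ g : Loss → ℝ, BddMeasurable g →
      ∫ y, g y ∂(ν j : Measure Loss) = ∫ y, g y * Real.exp (w j y) ∂(ν₀ j : Measure Loss))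
    {T : ℕ} {f : (Fin T → Obs K) → ℝ} (hf : BddMeasurable f) {N l : ℝ} (hl : 0 < l)
    (hfN : ∀ o, f o ∈ Set.Icc 0 N) :
    ∫ h, f (observe h) ∂historyMeasure π (productEnv ν) T ≤
      ∫ h, f (observe h) ∂historyMeasure π (productEnv ν₀) T +
        N * (2 / l - l / 2 * ∫ h, ∑ s, ∫ y, w (h s).2.2 y ∂(ν₀ (h s).2.2 : Measure Loss)
          ∂historyMeasure π (productEnv ν₀) T) := by
  have hmass := integral_observe_productEnv_eq π hw hν (BddMeasurable.const (X := Fin T → Obs K) 1)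
  simp only [integral_const, probReal_univ, one_smul, one_mul] at hmass
  rw [integral_observe_productEnv_eq π hw hν hf,
    ← integral_sum_productEnv π ν₀ T Prod.snd (bddMeasurable_logLik hw)]
  exact integral_mul_exp_le (hf.comp measurable_observe)
    ((bddMeasurable_sum_logLik T hw).comp measurable_observe) hmass.symm hl fun h => hfN _

end ProductEnv

section Coins

/-- The law of a loss with values in `{0, 1}` and mean `(1 - δ) / 2`. -/
noncomputable def biasedCoin (δ : unitInterval) : ProbabilityMeasure Loss :=
  ⟨bernoulliMeasure 0 1 ⟨(1 + δ) / 2, by linarith [δ.2.1], by linarith [δ.2.2]⟩, inferInstance⟩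

/-- The logarithm of the likelihood ratio of `biasedCoin δ` and a fair coin on `{0, 1}`, extended
to an affine function on `[0, 1]`. -/
noncomputable def coinLogLik (δ : unitInterval) (y : Loss) : ℝ :=
  (1 - y) * Real.log (1 + δ) + y * Real.log (1 - δ)

theorem integral_biasedCoin (δ : unitInterval) (g : Loss → ℝ) :
    ∫ y, g y ∂(biasedCoin δ : Measure Loss) = ((1 + δ) * g 0 + (1 - δ) * g 1) / 2 := by
  refine (integral_bernoulliMeasure 0 1 _ g).trans ?_
  simp only [smul_eq_mul]
  ring

theorem bddMeasurable_coe_loss : BddMeasurable fun y : Loss => (y : ℝ) :=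
  .of_mem_Icc measurable_subtype_coe Subtype.property

theorem bddMeasurable_coinLogLik (δ : unitInterval) : BddMeasurable (coinLogLik δ) :=
  (((BddMeasurable.const 1).sub bddMeasurable_coe_loss).mul (.const _)).add
    (bddMeasurable_coe_loss.mul (.const _))

theorem integral_biasedCoin_eq_integral_fair {δ : unitInterval} (hδ : (δ : ℝ) < 1) (g : Loss → ℝ) :
    ∫ y, g y ∂(biasedCoin δ : Measure Loss) =
      ∫ y, g y * Real.exp (coinLogLik δ y) ∂(biasedCoin 0 : Measure Loss) := by
  have hpos : 0 < 1 + (δ : ℝ) := by linarith [δ.2.1]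
  simp only [integral_biasedCoin, coinLogLik, Set.Icc.coe_zero, Set.Icc.coe_one, sub_zero, sub_self,
    one_mul, zero_mul, add_zero, zero_add, Real.exp_log hpos, Real.exp_log (sub_pos.2 hδ)]
  ring

theorem neg_le_log_one_sub {u : ℝ} (h0 : 0 ≤ u) (h1 : u ≤ 1 / 2) :
    -(2 * u) ≤ Real.log (1 - u) := by
  have hpos : 0 < 1 - u := by linarith
  have hinv : (1 - u)⁻¹ ≤ 1 + 2 * u := by
    rw [inv_le_iff_one_le_mul₀ hpos]
    nlinarith
  linarith [Real.one_sub_inv_le_log_of_pos hpos]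

theorem neg_sq_le_integral_coinLogLik {δ : unitInterval} (hδ : (δ : ℝ) ≤ 1 / 2) :
    -(δ : ℝ) ^ 2 ≤ ∫ y, coinLogLik δ y ∂(biasedCoin 0 : Measure Loss) := by
  have hδ0 := δ.2.1
  have hlog := neg_le_log_one_sub (sq_nonneg (δ : ℝ)) (by nlinarith)
  have hfactor : 1 - (δ : ℝ) ^ 2 = (1 + δ) * (1 - δ) := by ring
  rw [hfactor, Real.log_mul (by linarith) (by linarith)] at hlog
  simp only [integral_biasedCoin, coinLogLik, Set.Icc.coe_zero, Set.Icc.coe_one, sub_zero, sub_self,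
    one_mul, zero_mul, add_zero, zero_add]
  linarith

end Coins

section Counting

variable {K T : ℕ}

/-- The number of rounds in which the arm `a` occurs in a sequence of arms. -/
noncomputable def armCount (x : Fin T → Fin K) (a : Fin K) : ℝ :=
  ∑ s, if x s = a then 1 else 0

theorem armCount_mem_Icc (x : Fin T → Fin K) (a : Fin K) : armCount x a ∈ Set.Icc (0 : ℝ) T := by
  have hle := Finset.sum_le_sum (s := .univ) (f := fun s => if x s = a then (1 : ℝ) else 0)
    (g := fun _ => 1) fun s _ => by split_ifs <;> norm_num
  exact ⟨Finset.sum_nonneg fun s _ => by split_ifs <;> norm_num, by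
    simpa only [armCount, Finset.sum_const, Finset.card_univ, Fintype.card_fin, nsmul_one]
      using hle⟩

theorem bddMeasurable_armCount {X : Type*} [MeasurableSpace X] {φ : X → Fin K} (hφ : Measurable φ)
    (a : Fin K) : BddMeasurable fun h : Fin T → X => armCount (fun s => φ (h s)) a :=
  .sum _ fun s => (BddMeasurable.of_finite fun i => if i = a then (1 : ℝ) else 0).comp
    (hφ.comp (measurable_pi_apply s))

theorem sum_integral_armCount {X : Type*} [MeasurableSpace X] (μ : Measure (Fin T → X))
    [IsProbabilityMeasure μ] {φ : X → Fin K} (hφ : Measurable φ) :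
    ∑ a, ∫ h, armCount (fun s => φ (h s)) a ∂μ = T := by
  rw [← integral_finsetSum _ fun a _ => (bddMeasurable_armCount hφ a).integrable μ]
  simp only [armCount, Finset.sum_comm (s := Finset.univ (α := Fin K)), Finset.sum_ite_eq,
    Finset.mem_univ, if_true, Finset.sum_const, Finset.card_univ, Fintype.card_fin, nsmul_one,
    integral_const, probReal_univ, one_smul]

end Counting

section LowerBound

variable {K : ℕ}

/-- The biases of coins all of which are fair, except for the coin `a` of bias `δ`. -/
noncomputable def spike (a : Fin K) (δ : unitInterval) : Fin K → unitInterval := Pi.single a δ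

theorem coe_spike (a : Fin K) (δ : unitInterval) (i : Fin K) :
    (spike a δ i : ℝ) = δ * if i = a then 1 else 0 := by
  by_cases hi : i = a
  · subst hi
    simp [spike]
  · simp [spike, hi]

theorem spike_le (a : Fin K) (δ : unitInterval) (i : Fin K) : (spike a δ i : ℝ) ≤ δ := by
  rw [coe_spike]
  exact mul_le_of_le_one_right δ.2.1 (by split_ifs <;> norm_num)

/-- The environment whose losses are independent coins, all of them fair except that the mean loss
of the arm `a` is `(1 - δ) / 2`. -/
noncomputable def spikedEnv (a : Fin K) (δ : unitInterval) : Environment K :=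
  productEnv fun i => biasedCoin (spike a δ i)

/-- The environment whose losses are independent fair coins. -/
noncomputable def fairEnv (K : ℕ) : Environment K :=
  productEnv fun _ => biasedCoin 0

variable (π : Policy K)

theorem integral_sum_loss_spikedEnv (a : Fin K) (δ : unitInterval) (T : ℕ)
    (φ : Fin K × Fin K → Fin K) :
    ∫ h, ∑ s, ((h s).1 (φ (h s).2) : ℝ) ∂historyMeasure π (spikedEnv a δ) T =
      (T - δ * ∫ h, armCount (fun s => φ (h s).2) a ∂historyMeasure π (spikedEnv a δ) T) / 2 := by
  have hcount := bddMeasurable_armCount (T := T) (X := Round K) (φ := fun x => φ x.2)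
    ((measurable_of_finite φ).comp measurable_snd) a
  have hmean (i : Fin K) : ∫ y, (y : ℝ) ∂(biasedCoin (spike a δ i) : Measure Loss) =
      1 / 2 - δ / 2 * if i = a then 1 else 0 := by
    rw [integral_biasedCoin, coe_spike, Set.Icc.coe_zero, Set.Icc.coe_one]
    ring
  calc ∫ h, ∑ s, ((h s).1 (φ (h s).2) : ℝ) ∂historyMeasure π (spikedEnv a δ) T
      = ∫ h, ∑ s, ∫ y, (y : ℝ) ∂(biasedCoin (spike a δ (φ (h s).2)) : Measure Loss)
          ∂historyMeasure π (spikedEnv a δ) T :=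
        integral_sum_productEnv π _ T φ (bddMeasurable_coe_loss.comp measurable_snd)
    _ = ∫ h, ((T : ℝ) / 2 - (δ : ℝ) / 2 * armCount (fun s => φ (h s).2) a)
          ∂historyMeasure π (spikedEnv a δ) T := by
        simp only [hmean, Finset.sum_sub_distrib, ← Finset.mul_sum, Finset.sum_const,
          Finset.card_univ, Fintype.card_fin, nsmul_eq_mul, mul_one_div, armCount]
    _ = _ := by
        rw [integral_sub (integrable_const _) ((hcount.integrable _).const_mul _),
          integral_const_mul, integral_const, probReal_univ, one_smul]
        ring

theorem le_pseudoRegret_spikedEnv (a : Fin K) (δ : unitInterval) (T : ℕ) :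
    (δ : ℝ) / 2 * (T - ∫ h, armCount (fun s => (h s).2.1) a ∂historyMeasure π (spikedEnv a δ) T) ≤
      pseudoRegret π (spikedEnv a δ) T := by
  have hinf := ciInf_le (Set.finite_range fun i : Fin K =>
    ∫ h, ∑ s, ((h s).1 i : ℝ) ∂historyMeasure π (spikedEnv a δ) T).bddBelow a
  have hexploit := integral_sum_loss_spikedEnv π a δ T Prod.fst
  have hconst := integral_sum_loss_spikedEnv π a δ T fun _ => a
  simp only [armCount, if_true, Finset.sum_const, Finset.card_univ, Fintype.card_fin, nsmul_eq_mul,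
    mul_one, integral_const, probReal_univ, one_smul] at hconst
  rw [hconst] at hinf
  rw [pseudoRegret, hexploit]
  linarith

theorem integral_exploitCount_spikedEnv_le (a : Fin K) {δ : unitInterval} (hδ : (δ : ℝ) ≤ 1 / 2)
    (T : ℕ) {l : ℝ} (hl : 0 < l) :
    ∫ h, armCount (fun s => (h s).2.1) a ∂historyMeasure π (spikedEnv a δ) T ≤
      ∫ h, armCount (fun s => (h s).2.1) a ∂historyMeasure π (fairEnv K) T +
        T * (2 / l + l / 2 * δ ^ 2 *
          ∫ h, armCount (fun s => (h s).2.2) a ∂historyMeasure π (fairEnv K) T) := by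
  have hspike (j : Fin K) : (spike a δ j : ℝ) ≤ 1 / 2 := (spike_le a δ j).trans hδ
  have hchange := integral_observe_productEnv_le π (ν₀ := fun _ => biasedCoin 0)
    (ν := fun j => biasedCoin (spike a δ j))
    (fun j => bddMeasurable_coinLogLik (spike a δ j))
    (fun j g _ => integral_biasedCoin_eq_integral_fair ((hspike j).trans_lt (by norm_num)) g)
    (bddMeasurable_armCount (T := T) (φ := fun o : Obs K => o.1.1) (by fun_prop) a) hl
    fun o => armCount_mem_Icc _ a
  have hcount := bddMeasurable_armCount (T := T) (φ := fun x : Round K => x.2.2) (by fun_prop) a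
  have hlik : BddMeasurable fun h : Fin T → Round K =>
      ∑ s, ∫ y, coinLogLik (spike a δ (h s).2.2) y ∂(biasedCoin 0 : Measure Loss) :=
    .sum _ fun s => (BddMeasurable.of_finite fun j => ∫ y, coinLogLik (spike a δ j) y
      ∂(biasedCoin 0 : Measure Loss)).comp (by fun_prop)
  have hinfo : -(δ : ℝ) ^ 2 *
        ∫ h, armCount (fun s => (h s).2.2) a ∂historyMeasure π (fairEnv K) T ≤
      ∫ h, ∑ s, ∫ y, coinLogLik (spike a δ (h s).2.2) y ∂(biasedCoin 0 : Measure Loss)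
        ∂historyMeasure π (fairEnv K) T := by
    rw [← integral_const_mul]
    refine integral_mono ((hcount.integrable _).const_mul _) (hlik.integrable _) fun h => ?_
    rw [armCount, Finset.mul_sum]
    refine Finset.sum_le_sum fun s _ => le_trans ?_ (neg_sq_le_integral_coinLogLik (hspike _))
    rw [coe_spike]
    split_ifs <;> simp
  refine hchange.trans (add_le_add le_rfl (mul_le_mul_of_nonneg_left ?_ T.cast_nonneg))
  change 2 / l - l / 2 * ∫ h, ∑ s, ∫ y, coinLogLik (spike a δ (h s).2.2) y
    ∂(biasedCoin 0 : Measure Loss) ∂historyMeasure π (fairEnv K) T ≤ _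
  linarith [mul_le_mul_of_nonneg_left hinfo (half_pos hl).le]

theorem exists_integral_exploitCount_spikedEnv_le [NeZero K] {δ : unitInterval}
    (hδ : (δ : ℝ) ≤ 1 / 2) (T : ℕ) {l : ℝ} (hl : 0 < l) :
    ∃ a, ∫ h, armCount (fun s => (h s).2.1) a ∂historyMeasure π (spikedEnv a δ) T ≤
      T * (1 / K + 2 / l + l / 2 * δ ^ 2 * T / K) := by
  have hK : (0 : ℝ) < K := Nat.cast_pos.2 (Nat.pos_of_neZero K)
  have hexploit := sum_integral_armCount (T := T) (historyMeasure π (fairEnv K) T)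
    (φ := fun x : Round K => x.2.1) (by fun_prop)
  have hexplore := sum_integral_armCount (T := T) (historyMeasure π (fairEnv K) T)
    (φ := fun x : Round K => x.2.2) (by fun_prop)
  obtain ⟨a, -, ha⟩ := Finset.exists_le_of_sum_le Finset.univ_nonempty <|
    calc ∑ a, ∫ h, armCount (fun s => (h s).2.1) a ∂historyMeasure π (spikedEnv a δ) T
        ≤ ∑ a, (∫ h, armCount (fun s => (h s).2.1) a ∂historyMeasure π (fairEnv K) T +
            T * (2 / l + l / 2 * δ ^ 2 *
              ∫ h, armCount (fun s => (h s).2.2) a ∂historyMeasure π (fairEnv K) T)) :=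
          Finset.sum_le_sum fun a _ => integral_exploitCount_spikedEnv_le π a hδ T hl
      _ = ∑ _ : Fin K, T * (1 / K + 2 / l + l / 2 * δ ^ 2 * T / K) := by
          simp only [Finset.sum_add_distrib, ← Finset.mul_sum, hexploit, hexplore, Finset.sum_const,
            Finset.card_univ, Fintype.card_fin, nsmul_eq_mul]
          field_simp
          ring
  exact ⟨a, ha⟩

theorem exists_le_pseudoRegret {T : ℕ} (hK : 2 ≤ K) (hKT : K ≤ T) :
    ∃ ν : ProbabilityMeasure (Fin K → Loss),
      1 / 64 * √((K : ℝ) * (T : ℝ)) ≤ pseudoRegret π (Environment.iid ν) T := by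
  have hK2 : (2 : ℝ) ≤ K := by exact_mod_cast hK
  have hK0 : (0 : ℝ) < K := by linarith
  have hT0 : (0 : ℝ) < T := hK0.trans_le (by exact_mod_cast hKT)
  have : NeZero K := ⟨by omega⟩
  have hratio : √((K : ℝ) / T) ≤ 1 :=
    Real.sqrt_le_one.2 ((div_le_one hT0).2 (by exact_mod_cast hKT))
  obtain ⟨δ, hδ⟩ : ∃ δ : unitInterval, (δ : ℝ) = √((K : ℝ) / T) / 8 :=
    ⟨⟨√((K : ℝ) / T) / 8, by positivity, by linarith⟩, rfl⟩
  have hδT : (δ : ℝ) ^ 2 * T = K / 64 := by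
    rw [hδ, div_pow, Real.sq_sqrt (by positivity)]
    field_simp
    norm_num
  obtain ⟨a, ha⟩ := exists_integral_exploitCount_spikedEnv_le π (δ := δ) (by linarith) T
    (l := 16) (by norm_num)
  refine ⟨.pi fun i => biasedCoin (spike a δ i), ?_⟩
  have hhalf : 1 / (K : ℝ) ≤ 1 / 2 := by gcongr
  have hcount : 1 / (K : ℝ) + 2 / 16 + 16 / 2 * δ ^ 2 * T / K ≤ 3 / 4 := by
    have hinfo : 16 / 2 * (δ : ℝ) ^ 2 * T / K = 1 / 8 := by
      rw [mul_assoc, hδT]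
      field_simp
      norm_num
    linarith
  have hsqrt : √((K : ℝ) * T) = 8 * δ * T := by
    rw [hδ, Real.sqrt_div hK0.le, Real.sqrt_mul hK0.le]
    field_simp
    rw [Real.sq_sqrt hT0.le]
  calc 1 / 64 * √((K : ℝ) * T) = (δ : ℝ) / 2 * (T - T * (3 / 4)) := by rw [hsqrt]; ring
    _ ≤ δ / 2 * (T - ∫ h, armCount (fun s => (h s).2.1) a
          ∂historyMeasure π (spikedEnv a δ) T) := by
        have hδ0 : 0 ≤ (δ : ℝ) / 2 := div_nonneg δ.2.1 zero_le_two
        gcongr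
        exact ha.trans (by gcongr)
    _ ≤ _ := le_pseudoRegret_spikedEnv π a δ T

end LowerBound

end DecoupledBandit

theorem theorem1 :
    (∀ (α : ℝ) (hα : 1 < α) (c : ℝ) (hc : 0 < c), ∃ C : ℝ,
      ∀ (K : ℕ) [NeZero K] (R : DecoupledBandit.RankRule K)
        (env : DecoupledBandit.Environment K) (T : ℕ),
        DecoupledBandit.pseudoRegret
            (DecoupledBandit.ftpl α hα (DecoupledBandit.learningRate α c K)
              (DecoupledBandit.learningRate_pos α hc K) R) env T
          ≤ C * √((K : ℝ) * (T : ℝ))) ∧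
    (∃ c₀ : ℝ, 0 < c₀ ∧
      ∀ (K T : ℕ), 2 ≤ K → K ≤ T → ∀ π : DecoupledBandit.Policy K,
        ∃ ν : MeasureTheory.ProbabilityMeasure (Fin K → DecoupledBandit.Loss),
          c₀ * √((K : ℝ) * (T : ℝ))
            ≤ DecoupledBandit.pseudoRegret π (DecoupledBandit.Environment.iid ν) T) := by
  constructor
  · intro α hα c hc
    exact ⟨_, fun K _ R env T =>
      DecoupledBandit.pseudoRegret_ftpl_learningRate_le hα hc R env T⟩
  · exact ⟨1 / 64, by norm_num, fun K T hK hKT π =>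
      DecoupledBandit.exists_le_pseudoRegret π hK hKT⟩
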